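/- Let $\Omega\subset\mathbb{R}^N$ be a bounded, open, convex set. Let $p:\Omega\to(1,\infty)$ be measurable with $1<\operatorname{ess\,inf}p\le\operatorname{ess\,sup}p<\infty$, and put $q(x)=\frac{p(x)}{p(x)-1}$. Let $G:[0,\infty)\to\mathbb{R}$ be convex with $G(0)=0$ and $G\in C^2((0,\infty))$. Let $M_2>0$ be such that $\inf_{t\in(0,M_2]}G''(t)>0$, and let $\rho_0$ be a probability density on $\Omega$ with $\rho_0\le M_2$ a.e. Consider the problem $$\partial_t\rho=\operatorname{div}_x\!\left(\rho\,|\nabla_xG'(\rho)|^{q(x)-2}\nabla_xG'(\rho)\right)\ \text{in }(0,\infty)\times\Omega,\qquad \rho(0,\cdot)=\rho_0,\qquad \rho\,|\nabla_xG'(\rho)|^{q(x)-2}\nabla_xG'(\rho)\cdot\nu=0\ \text{on }\partial\Omega. \tag{1}$$ A weak solution of (1) is a nonnegative function $\rho\in L^\infty((0,\infty)\times\Omega)$ with $\rho(0,\cdot)=\rho_0$ such that $G'(\rho)$ is finite a.e. ($G'(0)$ is the one-sided derivative), belongs to the energy space, and $$\int_{(0,\infty)\times\Omega}\rho\left[\partial_t\phi-\left\langle|\nabla_xG'(\rho)|^{q(x)-2}\nabla_xG'(\rho),\nabla_x\phi\right\rangle\right]dt\,dx=-\int_\Omega\rho_0\,\phi(0,x)\,dx$$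 for every $\phi\in C_c^\infty(\mathbb{R}\times\mathbb{R}^N)$. Here $u$ belongs to the energy space if, for every $T<\infty$, $u$ and its weak spatial gradient $\nabla_xu$ lie in $L^{q(\cdot)}((0,T)\times\Omega)$, and $u$ is a limit, in the norm $\|u\|_{L^{q(\cdot)}((0,T)\times\Omega)}+\|\nabla_xu\|_{L^{q(\cdot)}((0,T)\times\Omega)}$, of restrictions of functions in $C^\infty(\mathbb{R}\times\mathbb{R}^N)$. Let $\rho^1,\rho^2$ be two weak solutions of (1) with the same initial datum $\rho_0$, such that $\partial_t\rho^i\in L^1((0,T)\times\Omega)$ for every $T<\infty$, where $\rho^i$ is identified with its representative $\rho^i(t,\cdot)=\rho^i(0,\cdot)+\int_0^t\partial_t\rho^i(s,\cdot)\,ds$, continuous in $t$ with values in $L^1(\Omega)$. Then, for all $T\ge0$, $$\int_\Omega\left[\rho^1(T,x)-\rho^2(T,x)\right]^+dx\le0,$$ and $\rho^1(T,\cdot)=\rho^2(T,\cdot)$ a.e. in $\Omega$. Thus the weak solution of (1) with integrable time derivative is unique. -/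

import Mathlib

open MeasureTheory Set Filter Topology
open scoped ENNReal ContDiff

/-- Euclidean space `ℝ^N`. -/
abbrev Euc (N : ℕ) : Type := EuclideanSpace ℝ (Fin N)

/-- Lebesgue measure on the space-time cylinder `(0, T) × Ω`. -/
noncomputable def spaceTimeMeasure {N : ℕ} (Ω : Set (Euc N)) (T : ℝ) : Measure (ℝ × Euc N) :=
  (volume.restrict (Ioo 0 T)).prod (volume.restrict Ω)

/-- Lebesgue measure on `(0, ∞) × Ω`. -/
noncomputable def halfSpaceTimeMeasure {N : ℕ} (Ω : Set (Euc N)) : Measure (ℝ × Euc N) :=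
  (volume.restrict (Ioi 0)).prod (volume.restrict Ω)

/-- `p` is measurable on `Ω` and `1 < ess inf p ≤ ess sup p < ∞`. -/
def IsVariableExponent {N : ℕ} (Ω : Set (Euc N)) (p : Euc N → ℝ) : Prop :=
  AEMeasurable p (volume.restrict Ω) ∧
    ∃ a b : ℝ, 1 < a ∧ ∀ᵐ x ∂(volume.restrict Ω), a ≤ p x ∧ p x ≤ b

/-- The conjugate exponent `q(x) = p(x) / (p(x) - 1)`. -/
noncomputable def conjExponent {N : ℕ} (p : Euc N → ℝ) (x : Euc N) : ℝ := p x / (p x - 1)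

/-- The energy density `G` is convex on `[0, ∞)`, vanishes at `0`, and is `C²` on `(0, ∞)`. -/
structure IsEnergyDensity (G : ℝ → ℝ) : Prop where
  convex : ConvexOn ℝ (Ici 0) G
  zero : G 0 = 0
  contDiff : ContDiffOn ℝ 2 G (Ioi 0)

/-- `G''` is bounded below by a positive constant on `(0, M]`. -/
def UniformlyConvexUpTo (G : ℝ → ℝ) (M : ℝ) : Prop :=
  ∃ c : ℝ, 0 < c ∧ ∀ s ∈ Ioc 0 M, c ≤ deriv (deriv G) s

/-- `ρ₀` is a probability density on `Ω` with `ρ₀ ≤ M`. -/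
structure IsBoundedDensity {N : ℕ} (Ω : Set (Euc N)) (M : ℝ) (ρ₀ : Euc N → ℝ) : Prop where
  integrable : IntegrableOn ρ₀ Ω
  nonneg : ∀ᵐ x ∂(volume.restrict Ω), 0 ≤ ρ₀ x
  mass : ∫ x in Ω, ρ₀ x = 1
  le : ∀ᵐ x ∂(volume.restrict Ω), ρ₀ x ≤ M

/-- The derivative `G'` of `G : [0, ∞) → ℝ`; at `0` it is the one-sided derivative. -/
noncomputable def energyDeriv (G : ℝ → ℝ) (s : ℝ) : ℝ := derivWithin G (Ici 0) s

/-- The spatial gradient at `(t, x)` of a differentiable function `φ(t, x)`. -/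
noncomputable def spaceGrad {N : ℕ} (φ : ℝ → Euc N → ℝ) (t : ℝ) (x : Euc N) : Euc N :=
  gradient (φ t) x

/-- The modular `∫∫ |f(t, x)|^{q(x)} dt dx` of the variable exponent Lebesgue space on
`(0, T) × Ω`. -/
noncomputable def modular {N : ℕ} {F : Type*} [NormedAddCommGroup F] (Ω : Set (Euc N))
    (q : Euc N → ℝ) (T : ℝ) (f : ℝ → Euc N → F) : ℝ≥0∞ :=
  ∫⁻ z, ‖f z.1 z.2‖ₑ ^ q z.2 ∂(spaceTimeMeasure Ω T)

/-- `f ∈ L^{q(·)}((0, T) × Ω)`. For an essentially bounded exponent, the modular of `f / λ` is at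
most `1` for some `λ > 0` if and only if the modular of `f` is finite. -/
def MemVarLp {N : ℕ} {F : Type*} [NormedAddCommGroup F] (Ω : Set (Euc N))
    (q : Euc N → ℝ) (T : ℝ) (f : ℝ → Euc N → F) : Prop :=
  AEStronglyMeasurable (fun z : ℝ × Euc N => f z.1 z.2) (spaceTimeMeasure Ω T) ∧ modular Ω q T f < ⊤

/-- `w` is the weak (distributional) spatial gradient of `u` on `(0, ∞) × Ω`. -/
def IsWeakSpaceGrad {N : ℕ} (Ω : Set (Euc N)) (u : ℝ → Euc N → ℝ) (w : ℝ → Euc N → Euc N) :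
    Prop :=
  ∀ φ : ℝ → Euc N → ℝ, ContDiff ℝ ∞ (fun z : ℝ × Euc N => φ z.1 z.2) →
    HasCompactSupport (fun z : ℝ × Euc N => φ z.1 z.2) →
    tsupport (fun z : ℝ × Euc N => φ z.1 z.2) ⊆ Ioi 0 ×ˢ Ω →
    ∀ e : Euc N,
      ∫ z, u z.1 z.2 * inner ℝ (spaceGrad φ z.1 z.2) e ∂(halfSpaceTimeMeasure Ω) =
        -∫ z, inner ℝ (w z.1 z.2) e * φ z.1 z.2 ∂(halfSpaceTimeMeasure Ω)

/-- `u` lies in the energy space on `(0, T) × Ω` for every `T`, with weak spatial gradient `w`: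
`u` and `w` are in `L^{q(·)}((0, T) × Ω)`, and `u` is a limit, in the norm
`‖u‖_{L^{q(·)}} + ‖∇u‖_{L^{q(·)}}`, of functions that are smooth up to the boundary. (For an
essentially bounded exponent, norm convergence is convergence of the modulars.) -/
structure IsEnergyFunction {N : ℕ} (Ω : Set (Euc N)) (q : Euc N → ℝ) (u : ℝ → Euc N → ℝ)
    (w : ℝ → Euc N → Euc N) : Prop where
  weakGrad : IsWeakSpaceGrad Ω u w
  memFun : ∀ T : ℝ, 0 < T → MemVarLp Ω q T u
  memGrad : ∀ T : ℝ, 0 < T → MemVarLp Ω q T w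
  approx : ∀ T : ℝ, 0 < T → ∃ ψ : ℕ → ℝ → Euc N → ℝ,
    (∀ n, ContDiff ℝ ∞ (fun z : ℝ × Euc N => ψ n z.1 z.2)) ∧
    Tendsto (fun n => modular Ω q T (fun t x => ψ n t x - u t x)) atTop (𝓝 0) ∧
    Tendsto (fun n => modular Ω q T (fun t x => spaceGrad (ψ n) t x - w t x)) atTop (𝓝 0)

/-- `ρ` is a bounded nonnegative weak solution of
`∂_t ρ = div (ρ |∇G'(ρ)|^{q(x)-2} ∇G'(ρ))` in `(0, ∞) × Ω`, `ρ(0, ·) = ρ₀`, with the no-flux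
condition on `∂Ω`, which is expressed by test functions that need not vanish on `∂Ω`. -/
structure IsWeakSolution {N : ℕ} (Ω : Set (Euc N)) (q : Euc N → ℝ) (G : ℝ → ℝ)
    (ρ₀ : Euc N → ℝ) (ρ : ℝ → Euc N → ℝ) : Prop where
  measurable : AEStronglyMeasurable (fun z : ℝ × Euc N => ρ z.1 z.2) (halfSpaceTimeMeasure Ω)
  nonneg : ∀ᵐ z ∂(halfSpaceTimeMeasure Ω), 0 ≤ ρ z.1 z.2
  bounded : ∃ C : ℝ, ∀ᵐ z ∂(halfSpaceTimeMeasure Ω), ρ z.1 z.2 ≤ C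
  initial : ∀ᵐ x ∂(volume.restrict Ω), ρ 0 x = ρ₀ x
  -- `G'(ρ)` is finite almost everywhere
  finiteDeriv : ∀ᵐ z ∂(halfSpaceTimeMeasure Ω), DifferentiableWithinAt ℝ G (Ici 0) (ρ z.1 z.2)
  equation : ∃ w : ℝ → Euc N → Euc N,
    IsEnergyFunction Ω q (fun t x => energyDeriv G (ρ t x)) w ∧
    ∀ φ : ℝ → Euc N → ℝ, ContDiff ℝ ∞ (fun z : ℝ × Euc N => φ z.1 z.2) →
      HasCompactSupport (fun z : ℝ × Euc N => φ z.1 z.2) →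
      ∫ z, ρ z.1 z.2 * (deriv (fun s => φ s z.2) z.1 -
          inner ℝ ((‖w z.1 z.2‖ ^ (q z.2 - 2)) • w z.1 z.2) (spaceGrad φ z.1 z.2))
            ∂(halfSpaceTimeMeasure Ω) =
        -∫ x in Ω, ρ₀ x * φ 0 x

/-- `∂_t ρ ∈ L¹((0, T) × Ω)` for every `T`: the curve `t ↦ ρ(t, ·)` is locally absolutely
continuous in `L¹(Ω)` on `[0, ∞)`, being the integral of its time derivative `d`. -/
def HasIntegrableTimeDeriv {N : ℕ} (Ω : Set (Euc N)) (ρ : ℝ → Euc N → ℝ) : Prop :=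
  ∃ d : ℝ → Euc N → ℝ,
    (∀ T : ℝ, 0 < T → Integrable (fun z : ℝ × Euc N => d z.1 z.2) (spaceTimeMeasure Ω T)) ∧
    ∀ t : ℝ, 0 ≤ t → ∀ᵐ x ∂(volume.restrict Ω), ρ t x = ρ 0 x + ∫ s in (0 : ℝ)..t, d s x

/-! Uniqueness is an L¹ comparison principle. Put `u i = G'(ρ i)` and `w i = ∇ (u i)`, let A be the
flux map `w ↦ |w|^(q-2) w`, and test the difference of the two equations with `θ(k (u₁ - u₂))`,
where θ is a smooth step from 0 to 1. As k grows, the time term tends to the integral of `∂_t (ρ₁ -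
ρ₂)` over `{u₁ > u₂}`. This set is `{ρ₁ > ρ₂}` because `G'` is strictly increasing on the range that
matters, so the chain rule for the positive part turns the limit into the integral of `(ρ₁ - ρ₂)⁺`
at time T.

The sign comes from the flux. Write `ρ₁ A(w₁) - ρ₂ A(w₂) = ρ₁ (A(w₁) - A(w₂)) + (ρ₁ - ρ₂) A(w₂)`.
Paired with `w₁ - w₂`, the first summand is nonnegative by monotonicity of A. The second carries the
factor `k θ'(k (u₁ - u₂))`, which lives on `0 < u₁ - u₂ < 1/k`. If `G'' ≥ c` then `ρ₁ - ρ₂ ≤ (u₁ -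
u₂) / c`, so this factor is absorbed and the term vanishes in the limit by dominated convergence.

The bound on `G''` holds only up to `M₂`, so `ρ ≤ M₂` is needed beforehand. It follows from the same
comparison against the constant solution `M₂`, whose gradient is zero, so that the second summand is
absent and no Lipschitz bound is required.

The main lemmas are `isWeakDivergence_of_weakForm` (localization in time),
`IsWeakDivergence.integral_comp` (nonlinear test functions),
`IsWeakDivergence.integral_indicator_nonpos` (the limit in k), `IsFluxSolution.le_of_initial_le`
(comparison) and `IsWeakSolution.le_of_initial_le` (the bound by `M₂`). -/

/-! ### Absolutely continuous functions of one variable. -/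

theorem AbsolutelyContinuousOnInterval.max_zero {f : ℝ → ℝ} {a b : ℝ}
    (hf : AbsolutelyContinuousOnInterval f a b) :
    AbsolutelyContinuousOnInterval (fun t => max (f t) 0) a b := by
  rw [absolutelyContinuousOnInterval_iff] at hf ⊢
  intro ε hε
  obtain ⟨δ, hδ, h⟩ := hf ε hε
  refine ⟨δ, hδ, fun E hE hs => lt_of_le_of_lt (Finset.sum_le_sum fun i _ => ?_) (h E hE hs)⟩
  rw [Real.dist_eq, Real.dist_eq]
  exact abs_max_sub_max_le_abs _ _ _

/-- The chain rule for the positive part of an absolutely continuous function. -/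
theorem max_zero_sub_eq_integral {d : ℝ → ℝ} {T r₀ : ℝ}
    (hd : IntervalIntegrable d volume 0 T) :
    max (r₀ + ∫ s in (0 : ℝ)..T, d s) 0 - max r₀ 0 =
      ∫ t in (0 : ℝ)..T, {t | 0 < r₀ + ∫ s in (0 : ℝ)..t, d s}.indicator d t := by
  set r : ℝ → ℝ := fun t => r₀ + ∫ s in (0 : ℝ)..t, d s with hr
  have hI := hd.absolutelyContinuousOnInterval_intervalIntegral (c := 0) (by simp)
  have hAC : AbsolutelyContinuousOnInterval r 0 T := by
    have hc : AbsolutelyContinuousOnInterval (fun _ : ℝ => r₀) 0 T :=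
      (contDiff_const.contDiffOn (n := 1)).absolutelyContinuousOnInterval
    exact hc.add hI
  have hp := hAC.max_zero
  have h1 := hp.integral_deriv_eq_sub
  have hr0 : r 0 = r₀ := by simp [hr]
  rw [hr0] at h1
  change max (r T) 0 - max r₀ 0 = _
  rw [← h1]
  apply intervalIntegral.integral_congr_ae
  filter_upwards [hd.ae_hasDerivAt_integral] with t h3 ht
  have ht' : t ∈ uIcc 0 T := uIoc_subset_uIcc ht
  have h3' : HasDerivAt r (d t) t := (h3 ht' 0 (by simp)).const_add r₀
  rcases lt_trichotomy (r t) 0 with h | h | h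
  · have : (fun t => max (r t) 0) =ᶠ[𝓝 t] fun _ => 0 := by
      filter_upwards [h3'.continuousAt.eventually_lt continuousAt_const h] with s hs
      exact max_eq_right hs.le
    rw [this.deriv_eq, indicator_of_notMem (by simpa [hr] using h.le)]
    simp
  -- At a zero of `r` the positive part is minimal, so its `deriv` is 0 whether or not it is
  -- differentiable there. Hence the zero set needs no separate measure argument.
  · have : IsLocalMin (fun t => max (r t) 0) t :=
      Eventually.of_forall fun s => by simp [h]
    rw [this.deriv_eq_zero, indicator_of_notMem (by simpa [hr] using h.le)]
  · have : (fun t => max (r t) 0) =ᶠ[𝓝 t] r := by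
      filter_upwards [continuousAt_const.eventually_lt h3'.continuousAt h] with s hs
      exact max_eq_left hs.le
    rw [this.deriv_eq, indicator_of_mem (by exact h), h3'.deriv]

theorem integral_primitive_mul_deriv {d φ : ℝ → ℝ} {T r₀ : ℝ}
    (hd : IntervalIntegrable d volume 0 T) (hφ : ContDiff ℝ 1 φ) (hφT : φ T = 0) :
    ∫ t in (0 : ℝ)..T, (r₀ + ∫ s in (0 : ℝ)..t, d s) * deriv φ t =
      -(r₀ * φ 0) - ∫ t in (0 : ℝ)..T, d t * φ t := by
  have hI := hd.absolutelyContinuousOnInterval_intervalIntegral (c := 0) (by simp)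
  have hAC : AbsolutelyContinuousOnInterval (fun t => r₀ + ∫ s in (0 : ℝ)..t, d s) 0 T := by
    have hc : AbsolutelyContinuousOnInterval (fun _ : ℝ => r₀) 0 T :=
      (contDiff_const.contDiffOn (n := 1)).absolutelyContinuousOnInterval
    exact hc.add hI
  rw [hAC.integral_mul_deriv_eq_deriv_mul hφ.contDiffOn.absolutelyContinuousOnInterval, hφT]
  simp only [mul_zero, intervalIntegral.integral_same, add_zero, zero_sub]
  congr 1
  apply intervalIntegral.integral_congr_ae
  filter_upwards [hd.ae_hasDerivAt_integral] with t h3 ht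
  rw [((h3 (uIoc_subset_uIcc ht) 0 (by simp)).const_add r₀).deriv]

/-! ### The smooth step function. -/

/-- The derivative of the smooth transition is supported in `[0, 1]`. -/
theorem Real.smoothTransition.deriv_eq_zero {x : ℝ} (hx : x ≤ 0 ∨ 1 ≤ x) :
    deriv Real.smoothTransition x = 0 := by
  rcases hx with hx | hx
  · have : IsLocalMin Real.smoothTransition x := Eventually.of_forall fun y => by
      rw [Real.smoothTransition.zero_of_nonpos hx]; exact Real.smoothTransition.nonneg y
    exact this.deriv_eq_zero
  · have : IsLocalMax Real.smoothTransition x := Eventually.of_forall fun y => by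
      rw [Real.smoothTransition.one_of_one_le hx]; exact Real.smoothTransition.le_one y
    exact this.deriv_eq_zero

theorem Real.smoothTransition.continuous_deriv : Continuous (deriv Real.smoothTransition) :=
  (Real.smoothTransition.contDiff (n := 1)).continuous_deriv (by norm_num)

theorem Real.smoothTransition.exists_deriv_le :
    ∃ K : ℝ, 0 ≤ K ∧ ∀ x, |deriv Real.smoothTransition x| ≤ K := by
  obtain ⟨K, hK⟩ := (isCompact_Icc (a := (0 : ℝ)) (b := 1)).exists_bound_of_continuousOn
    Real.smoothTransition.continuous_deriv.continuousOn
  refine ⟨max K 0, le_max_right _ _, fun x => ?_⟩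
  by_cases hx : x ∈ Icc (0 : ℝ) 1
  · exact (hK x hx).trans (le_max_left _ _)
  · rw [Real.smoothTransition.deriv_eq_zero]
    · simp
    · rw [mem_Icc, not_and_or, not_le, not_le] at hx
      exact hx.imp le_of_lt le_of_lt

/-! ### Measure on the cylinder and time derivatives. -/

theorem spaceTimeMeasure_eq_restrict {N : ℕ} (Ω : Set (Euc N)) (T : ℝ) :
    spaceTimeMeasure Ω T = (halfSpaceTimeMeasure Ω).restrict (Ioo 0 T ×ˢ univ) := by
  rw [spaceTimeMeasure, halfSpaceTimeMeasure, Measure.prod_restrict, Measure.prod_restrict,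
    Measure.restrict_restrict (measurableSet_Ioo.prod MeasurableSet.univ), prod_inter_prod,
    univ_inter, inter_eq_left.2 Ioo_subset_Ioi_self]

theorem spaceTimeMeasure_le {N : ℕ} (Ω : Set (Euc N)) (T : ℝ) :
    spaceTimeMeasure Ω T ≤ halfSpaceTimeMeasure Ω := by
  rw [spaceTimeMeasure_eq_restrict]; exact Measure.restrict_le_self

theorem ae_spaceTimeMeasure_mem {N : ℕ} {Ω : Set (Euc N)} (hΩ : MeasurableSet Ω) (T : ℝ) :
    ∀ᵐ z ∂(spaceTimeMeasure Ω T), z.1 ∈ Ioo 0 T ∧ z.2 ∈ Ω := by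
  rw [spaceTimeMeasure, Measure.prod_restrict]
  exact ae_restrict_mem (measurableSet_Ioo.prod hΩ)

theorem ae_spaceTimeMeasure_of_space {N : ℕ} {Ω : Set (Euc N)} {T : ℝ} {P : Euc N → Prop}
    (h : ∀ᵐ x ∂(volume.restrict Ω), P x) : ∀ᵐ z ∂(spaceTimeMeasure Ω T), P z.2 :=
  Measure.quasiMeasurePreserving_snd.ae h

theorem isFiniteMeasure_spaceTimeMeasure {N : ℕ} {Ω : Set (Euc N)}
    (hΩ : Bornology.IsBounded Ω) (T : ℝ) : IsFiniteMeasure (spaceTimeMeasure Ω T) := by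
  have : IsFiniteMeasure (volume.restrict Ω) := ⟨by simpa using hΩ.measure_lt_top⟩
  unfold spaceTimeMeasure
  infer_instance

/-- `d` is the time derivative of `ρ` on `(0, T) × Ω`, and `ρ₀` the initial value. -/
structure HasTimeDerivUpTo {N : ℕ} (Ω : Set (Euc N)) (T : ℝ) (ρ₀ : Euc N → ℝ)
    (ρ : ℝ → Euc N → ℝ) (d : ℝ → Euc N → ℝ) : Prop where
  integrable : Integrable (fun z : ℝ × Euc N => d z.1 z.2) (spaceTimeMeasure Ω T)
  eq_time : ∀ t ∈ Icc 0 T, ∀ᵐ x ∂(volume.restrict Ω), ρ t x = ρ₀ x + ∫ s in (0 : ℝ)..t, d s x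
  eq_ae : ∀ᵐ z ∂(spaceTimeMeasure Ω T), ρ z.1 z.2 = ρ₀ z.2 + ∫ s in (0 : ℝ)..z.1, d s z.2

theorem ae_ae_of_ae_prod_swap {α β : Type*} [MeasurableSpace α] [MeasurableSpace β]
    {μ : Measure α} {ν : Measure β} [SFinite μ] [SFinite ν] {P : α × β → Prop}
    (h : ∀ᵐ z ∂(μ.prod ν), P z) : ∀ᵐ y ∂ν, ∀ᵐ x ∂μ, P (x, y) := by
  rw [← Measure.prod_swap] at h
  exact Measure.ae_ae_of_ae_prod (ae_of_ae_map measurable_swap.aemeasurable h)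

/-- The variable upper limit is moved into an indicator, so that the primitive becomes a parametric
integral over the fixed interval `(0, T)` of a strongly measurable representative of `d`, which
agrees with `d` on almost every time slice. -/
theorem aestronglyMeasurable_primitive {N : ℕ} {Ω : Set (Euc N)} {T : ℝ} {d : ℝ → Euc N → ℝ}
    (hΩ : MeasurableSet Ω)
    (hd : Integrable (fun z : ℝ × Euc N => d z.1 z.2) (spaceTimeMeasure Ω T)) :
    AEStronglyMeasurable (fun z : ℝ × Euc N => ∫ s in (0 : ℝ)..z.1, d s z.2)
      (spaceTimeMeasure Ω T) := by
  obtain ⟨d', hd', hdd⟩ := hd.aestronglyMeasurable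
  have h1 : StronglyMeasurable (fun z : ℝ × Euc N =>
      ∫ s in Ioo 0 T, {y : (ℝ × Euc N) × ℝ | y.2 ≤ y.1.1}.indicator
        (fun y => d' (y.2, y.1.2)) (z, s)) := by
    apply StronglyMeasurable.integral_prod_right
    refine StronglyMeasurable.indicator ?_
      (measurableSet_le measurable_snd (measurable_fst.comp measurable_fst))
    exact hd'.comp_measurable
      (measurable_snd.prodMk (measurable_snd.comp measurable_fst))
  refine ⟨_, h1, ?_⟩
  have h2 := ae_ae_of_ae_prod_swap hdd
  filter_upwards [ae_spaceTimeMeasure_mem hΩ T, ae_spaceTimeMeasure_of_space (T := T) h2]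
    with z hz h3
  rw [intervalIntegral.integral_of_le hz.1.1.le]
  have h4 : (fun s => {y : (ℝ × Euc N) × ℝ | y.2 ≤ y.1.1}.indicator
        (fun y => d' (y.2, y.1.2)) (z, s)) = (Iic z.1).indicator fun s => d' (s, z.2) := by
    ext s; simp only [indicator]; rfl
  rw [h4, setIntegral_indicator measurableSet_Iic]
  have h5 : Ioo 0 T ∩ Iic z.1 = Ioc 0 z.1 := by
    ext s; simp only [mem_inter_iff, mem_Ioo, mem_Iic, mem_Ioc]
    constructor
    · rintro ⟨⟨a, b⟩, c⟩; exact ⟨a, c⟩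
    · rintro ⟨a, c⟩; exact ⟨⟨a, c.trans_lt hz.1.2⟩, c⟩
  rw [h5]
  apply integral_congr_ae
  have h6 : Ioc 0 z.1 ⊆ Ioo 0 T := fun s hs => ⟨hs.1, hs.2.trans_lt hz.1.2⟩
  exact ae_restrict_of_ae_restrict_of_subset h6 h3

/-- The hypothesis gives the identity for each time and almost every x, with an exceptional set
depending on the time. Fubini turns it into an identity almost everywhere on the cylinder, but only
for a measurable set of points; hence the passage to strongly measurable representatives of both
sides. -/
theorem HasIntegrableTimeDeriv.exists_upTo {N : ℕ} {Ω : Set (Euc N)} (hΩ : MeasurableSet Ω)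
    {ρ : ℝ → Euc N → ℝ} {ρ₀ : Euc N → ℝ} (h : HasIntegrableTimeDeriv Ω ρ)
    (hρ₀ : IntegrableOn ρ₀ Ω) (hinit : ∀ᵐ x ∂(volume.restrict Ω), ρ 0 x = ρ₀ x)
    (hρ : AEStronglyMeasurable (fun z : ℝ × Euc N => ρ z.1 z.2) (halfSpaceTimeMeasure Ω))
    {T : ℝ} (hT : 0 < T) : ∃ d : ℝ → Euc N → ℝ, HasTimeDerivUpTo Ω T ρ₀ ρ d := by
  obtain ⟨d, hdi, hd⟩ := h
  have hti : ∀ t ∈ Icc 0 T, ∀ᵐ x ∂(volume.restrict Ω),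
      ρ t x = ρ₀ x + ∫ s in (0 : ℝ)..t, d s x := by
    intro t ht
    filter_upwards [hinit, hd t ht.1] with x h1 h2
    rw [h2, h1]
  refine ⟨d, hdi T hT, hti, ?_⟩
  have hR : AEStronglyMeasurable
      (fun z : ℝ × Euc N => ρ₀ z.2 + ∫ s in (0 : ℝ)..z.1, d s z.2) (spaceTimeMeasure Ω T) :=
    AEStronglyMeasurable.add
      (hρ₀.aestronglyMeasurable.comp_quasiMeasurePreserving Measure.quasiMeasurePreserving_snd)
      (aestronglyMeasurable_primitive hΩ (hdi T hT))
  obtain ⟨f, hf, hfρ⟩ := hρ.mono_measure (spaceTimeMeasure_le Ω T)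
  obtain ⟨g, hg, hgR⟩ := hR
  have key : ∀ᵐ z ∂(spaceTimeMeasure Ω T), f z = g z := by
    rw [spaceTimeMeasure, Measure.ae_prod_iff_ae_ae (measurableSet_eq_fun hf.measurable hg.measurable)]
    filter_upwards [Measure.ae_ae_of_ae_prod hfρ, Measure.ae_ae_of_ae_prod hgR,
      ae_restrict_mem measurableSet_Ioo] with t h1 h2 ht
    filter_upwards [h1, h2, hti t ⟨ht.1.le, ht.2.le⟩] with x h3 h4 h5
    rw [← h3, ← h4, h5]
  filter_upwards [key, hfρ, hgR] with z h1 h2 h3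
  rw [h2, h1, ← h3]

theorem HasTimeDerivUpTo.ae_intervalIntegrable {N : ℕ} {Ω : Set (Euc N)} {T : ℝ} (hT : 0 ≤ T)
    {ρ₀ : Euc N → ℝ} {ρ d : ℝ → Euc N → ℝ} (h : HasTimeDerivUpTo Ω T ρ₀ ρ d) :
    ∀ᵐ x ∂(volume.restrict Ω), IntervalIntegrable (fun t => d t x) volume 0 T := by
  filter_upwards [Integrable.prod_left_ae h.integrable] with x hx
  rw [intervalIntegrable_iff_integrableOn_Ioo_of_le hT]
  exact hx

theorem integral_spaceTimeMeasure {N : ℕ} {Ω : Set (Euc N)} {T : ℝ} (hT : 0 ≤ T)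
    {f : ℝ × Euc N → ℝ} (hf : Integrable f (spaceTimeMeasure Ω T)) :
    ∫ z, f z ∂(spaceTimeMeasure Ω T) = ∫ x in Ω, ∫ t in (0 : ℝ)..T, f (t, x) := by
  rw [spaceTimeMeasure, integral_prod_symm _ hf]
  simp_rw [intervalIntegral.integral_of_le hT, integral_Ioc_eq_integral_Ioo]

/-- Integration by parts in time. -/
theorem HasTimeDerivUpTo.integral_mul_deriv {N : ℕ} {Ω : Set (Euc N)} {T : ℝ} (hT : 0 ≤ T)
    {ρ₀ : Euc N → ℝ} {ρ d : ℝ → Euc N → ℝ} (h : HasTimeDerivUpTo Ω T ρ₀ ρ d)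
    {φ : ℝ → Euc N → ℝ} (hφ : ∀ x, ContDiff ℝ 1 fun t => φ t x) (hφT : ∀ x, φ T x = 0)
    (hi₀ : IntegrableOn (fun x => ρ₀ x * φ 0 x) Ω)
    (hi : Integrable (fun z : ℝ × Euc N => ρ z.1 z.2 * deriv (fun s => φ s z.2) z.1)
      (spaceTimeMeasure Ω T))
    (hi' : Integrable (fun z : ℝ × Euc N => d z.1 z.2 * φ z.1 z.2) (spaceTimeMeasure Ω T)) :
    ∫ z, ρ z.1 z.2 * deriv (fun s => φ s z.2) z.1 ∂(spaceTimeMeasure Ω T) =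
      -(∫ x in Ω, ρ₀ x * φ 0 x) - ∫ z, d z.1 z.2 * φ z.1 z.2 ∂(spaceTimeMeasure Ω T) := by
  have h1 : (fun z : ℝ × Euc N => ρ z.1 z.2 * deriv (fun s => φ s z.2) z.1)
      =ᵐ[spaceTimeMeasure Ω T] fun z =>
        (ρ₀ z.2 + ∫ s in (0 : ℝ)..z.1, d s z.2) * deriv (fun s => φ s z.2) z.1 := by
    filter_upwards [h.eq_ae] with z hz
    rw [hz]
  rw [integral_congr_ae h1, integral_spaceTimeMeasure hT (hi.congr h1),
    integral_spaceTimeMeasure hT hi', ← integral_neg,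
    ← integral_sub (f := fun x => -(ρ₀ x * φ 0 x)) hi₀.neg]
  · apply integral_congr_ae
    filter_upwards [h.ae_intervalIntegrable hT] with x hx
    exact integral_primitive_mul_deriv hx (hφ x) (hφT x)
  · have := hi'.integral_prod_right
    refine this.congr (Eventually.of_forall fun x => ?_)
    simp only [intervalIntegral.integral_of_le hT, integral_Ioc_eq_integral_Ioo]

theorem HasTimeDerivUpTo.sub {N : ℕ} {Ω : Set (Euc N)} {T : ℝ} (hΩ : MeasurableSet Ω)
    {σ₁ σ₂ : Euc N → ℝ} {ρ₁ d₁ ρ₂ d₂ : ℝ → Euc N → ℝ} (h₁ : HasTimeDerivUpTo Ω T σ₁ ρ₁ d₁)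
    (h₂ : HasTimeDerivUpTo Ω T σ₂ ρ₂ d₂) :
    HasTimeDerivUpTo Ω T (fun x => σ₁ x - σ₂ x) (fun t x => ρ₁ t x - ρ₂ t x)
      (fun t x => d₁ t x - d₂ t x) where
  integrable := h₁.integrable.sub h₂.integrable
  eq_time t ht := by
    have hsub : uIcc 0 t ⊆ uIcc 0 T := by
      rw [uIcc_of_le ht.1, uIcc_of_le (ht.1.trans ht.2)]
      exact Icc_subset_Icc_right ht.2
    filter_upwards [h₁.eq_time t ht, h₂.eq_time t ht, h₁.ae_intervalIntegrable (ht.1.trans ht.2),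
      h₂.ae_intervalIntegrable (ht.1.trans ht.2)] with x e₁ e₂ i₁ i₂
    rw [intervalIntegral.integral_sub (i₁.mono_set hsub) (i₂.mono_set hsub), e₁, e₂]
    ring
  eq_ae := by
    rcases le_or_gt T 0 with hT | hT
    · have : spaceTimeMeasure Ω T = 0 := by simp [spaceTimeMeasure, Ioo_eq_empty hT.not_gt]
      simp [this]
    · filter_upwards [h₁.eq_ae, h₂.eq_ae, ae_spaceTimeMeasure_mem hΩ T,
        ae_spaceTimeMeasure_of_space (h₁.ae_intervalIntegrable hT.le),
        ae_spaceTimeMeasure_of_space (h₂.ae_intervalIntegrable hT.le)] with z e₁ e₂ hz i₁ i₂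
      have hsub : uIcc 0 z.1 ⊆ uIcc 0 T := by
        rw [uIcc_of_le hz.1.1.le, uIcc_of_le hT.le]
        exact Icc_subset_Icc_right hz.1.2.le
      rw [intervalIntegral.integral_sub (i₁.mono_set hsub) (i₂.mono_set hsub), e₁, e₂]
      ring

/-- If the integral of `∂_t ρ` over `{ρ > 0}` is nonpositive and `ρ` is initially nonpositive, then
`ρ` remains nonpositive. -/
theorem HasTimeDerivUpTo.nonpos_of_integral_indicator_nonpos {N : ℕ} {Ω : Set (Euc N)} {T : ℝ} (hT : 0 ≤ T)
    {ρ₀ : Euc N → ℝ} {ρ d : ℝ → Euc N → ℝ} (h : HasTimeDerivUpTo Ω T ρ₀ ρ d)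
    (hρ : AEStronglyMeasurable (fun z : ℝ × Euc N => ρ z.1 z.2) (spaceTimeMeasure Ω T))
    (hρ₀ : ∀ᵐ x ∂(volume.restrict Ω), ρ₀ x ≤ 0)
    (hle : ∫ z, {z : ℝ × Euc N | 0 < ρ z.1 z.2}.indicator (fun z => d z.1 z.2) z
      ∂(spaceTimeMeasure Ω T) ≤ 0) :
    ∀ᵐ x ∂(volume.restrict Ω), ρ T x ≤ 0 := by
  set R : ℝ × Euc N → ℝ := fun z => ρ₀ z.2 + ∫ s in (0 : ℝ)..z.1, d s z.2 with hR
  have h1 : {z : ℝ × Euc N | 0 < ρ z.1 z.2}.indicator (fun z => d z.1 z.2)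
      =ᵐ[spaceTimeMeasure Ω T] {z | 0 < R z}.indicator (fun z => d z.1 z.2) := by
    filter_upwards [h.eq_ae] with z hz
    simp only [indicator, mem_ofPred_eq, hz, hR]
  have hi : Integrable ({z : ℝ × Euc N | 0 < ρ z.1 z.2}.indicator (fun z => d z.1 z.2))
      (spaceTimeMeasure Ω T) :=
    h.integrable.indicator₀ (nullMeasurableSet_lt aemeasurable_const hρ.aemeasurable)
  have hi' := hi.congr h1
  rw [integral_congr_ae h1, integral_spaceTimeMeasure hT hi'] at hle
  have h2 : (fun x => ∫ t in (0 : ℝ)..T, {z | 0 < R z}.indicator (fun z => d z.1 z.2) (t, x))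
      =ᵐ[volume.restrict Ω] fun x => max (ρ T x) 0 := by
    filter_upwards [h.ae_intervalIntegrable hT, h.eq_time T ⟨hT, le_rfl⟩, hρ₀] with x hx hx2 hx3
    have := max_zero_sub_eq_integral (r₀ := ρ₀ x) hx
    rw [← hx2, max_eq_right hx3, sub_zero] at this
    rw [this]
    rfl
  -- Integrability is what makes the vanishing integral below informative, since the Bochner
  -- integral of a nonintegrable function is 0 by convention.
  have h3 : Integrable (fun x => max (ρ T x) 0) (volume.restrict Ω) := by
    refine Integrable.congr ?_ h2
    have := hi'.integral_prod_right
    refine this.congr (Eventually.of_forall fun x => ?_)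
    simp only [intervalIntegral.integral_of_le hT, integral_Ioc_eq_integral_Ioo]
  rw [integral_congr_ae h2] at hle
  have h4 : ∫ x in Ω, max (ρ T x) 0 = 0 :=
    le_antisymm hle (integral_nonneg fun x => le_max_right _ _)
  filter_upwards [(integral_eq_zero_iff_of_nonneg
    (f := fun x => max (ρ T x) 0) (fun x => le_max_right _ _) h3).1 h4] with x hx
  exact (le_max_left _ _).trans hx.le

/-! ### Derivatives of smooth functions on space-time. -/

theorem hasGradientAt_space {N : ℕ} {φ : ℝ → Euc N → ℝ}
    (hφ : Differentiable ℝ fun z : ℝ × Euc N => φ z.1 z.2) (t : ℝ) (x : Euc N) :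
    HasGradientAt (φ t) (spaceGrad φ t x) x := by
  have : DifferentiableAt ℝ (φ t) x :=
    (hφ (t, x)).comp x ((differentiableAt_const t).prodMk differentiableAt_id)
  exact this.hasGradientAt

theorem spaceGrad_eq {N : ℕ} {φ : ℝ → Euc N → ℝ}
    (hφ : Differentiable ℝ fun z : ℝ × Euc N => φ z.1 z.2) (t : ℝ) (x : Euc N) :
    spaceGrad φ t x = (InnerProductSpace.toDual ℝ (Euc N)).symm
      ((fderiv ℝ (fun z : ℝ × Euc N => φ z.1 z.2) (t, x)).comp
        (ContinuousLinearMap.inr ℝ ℝ (Euc N))) := by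
  unfold spaceGrad gradient
  congr 1
  exact ((hφ (t, x)).hasFDerivAt.comp x (hasFDerivAt_prodMk_right t x)).fderiv

theorem continuous_spaceGrad {N : ℕ} {φ : ℝ → Euc N → ℝ}
    (hφ : ContDiff ℝ 1 fun z : ℝ × Euc N => φ z.1 z.2) :
    Continuous fun z : ℝ × Euc N => spaceGrad φ z.1 z.2 := by
  simp_rw [spaceGrad_eq (hφ.differentiable one_ne_zero)]
  exact (LinearIsometryEquiv.continuous _).comp
    ((hφ.continuous_fderiv one_ne_zero).clm_comp continuous_const)

theorem contDiff_time {N : ℕ} {φ : ℝ → Euc N → ℝ} {n : WithTop ℕ∞}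
    (hφ : ContDiff ℝ n fun z : ℝ × Euc N => φ z.1 z.2) (x : Euc N) :
    ContDiff ℝ n fun t => φ t x :=
  hφ.comp (contDiff_id.prodMk contDiff_const)

theorem continuous_timeDeriv {N : ℕ} {φ : ℝ → Euc N → ℝ}
    (hφ : ContDiff ℝ 1 fun z : ℝ × Euc N => φ z.1 z.2) :
    Continuous fun z : ℝ × Euc N => deriv (fun s => φ s z.2) z.1 := by
  have : (fun z : ℝ × Euc N => deriv (fun s => φ s z.2) z.1) = fun z : ℝ × Euc N =>
      fderiv ℝ (fun z : ℝ × Euc N => φ z.1 z.2) z (1, 0) := by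
    ext z
    have h := ((hφ.differentiable one_ne_zero) z).hasFDerivAt.comp_hasDerivAt z.1
      ((hasDerivAt_id z.1).prodMk (hasDerivAt_const z.1 z.2))
    exact h.deriv
  rw [this]
  exact (hφ.continuous_fderiv one_ne_zero).clm_apply continuous_const

theorem exists_bound_ae_spaceTimeMeasure {N : ℕ} {Ω : Set (Euc N)} (hΩ : MeasurableSet Ω)
    (hΩb : Bornology.IsBounded Ω) (T : ℝ) {F : Type*} [NormedAddCommGroup F]
    {f : ℝ × Euc N → F} (hf : Continuous f) :
    ∃ C : ℝ, ∀ᵐ z ∂(spaceTimeMeasure Ω T), ‖f z‖ ≤ C := by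
  obtain ⟨C, hC⟩ := ((isCompact_Icc (a := (0 : ℝ)) (b := T)).prod
    hΩb.isCompact_closure).exists_bound_of_continuousOn hf.continuousOn
  refine ⟨C, ?_⟩
  filter_upwards [ae_spaceTimeMeasure_mem hΩ T] with z hz
  exact hC z ⟨Ioo_subset_Icc_self hz.1, subset_closure hz.2⟩

theorem exists_bound_space {N : ℕ} {Ω : Set (Euc N)} (hΩ : MeasurableSet Ω)
    (hΩb : Bornology.IsBounded Ω) {f : Euc N → ℝ} (hf : Continuous f) :
    ∃ C : ℝ, ∀ᵐ x ∂(volume.restrict Ω), ‖f x‖ ≤ C := by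
  obtain ⟨C, hC⟩ := hΩb.isCompact_closure.exists_bound_of_continuousOn hf.continuousOn
  exact ⟨C, (ae_restrict_mem hΩ).mono fun x hx => hC x (subset_closure hx)⟩

/-! ### Weak divergence on a finite cylinder. -/

/-- `∂_t ρ = div B` weakly on `(0, T) × Ω`, with no flux through `∂Ω`. -/
def IsWeakDivergence {N : ℕ} (Ω : Set (Euc N)) (T : ℝ) (d : ℝ × Euc N → ℝ)
    (B : ℝ × Euc N → Euc N) : Prop :=
  ∀ φ : ℝ → Euc N → ℝ, ContDiff ℝ ∞ (fun z : ℝ × Euc N => φ z.1 z.2) →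
    ∫ z, d z * φ z.1 z.2 ∂(spaceTimeMeasure Ω T) =
      -∫ z, inner ℝ (B z) (spaceGrad φ z.1 z.2) ∂(spaceTimeMeasure Ω T)

/-- A smooth cutoff in time. -/
noncomputable def timeCutoff (T : ℝ) (k : ℕ) (t : ℝ) : ℝ :=
  -- The shift by 1 makes the first factor vanish in a whole neighbourhood of `T`, so its derivative
  -- vanishes there too. The second factor is 1 for `t ≥ -1` and 0 for `t ≤ -2`: it gives compact
  -- support without disturbing the initial time.
  Real.smoothTransition (k * (T - t) - 1) * Real.smoothTransition (t + 2)

theorem contDiff_timeCutoff (T : ℝ) (k : ℕ) : ContDiff ℝ ∞ (timeCutoff T k) := by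
  unfold timeCutoff
  exact (Real.smoothTransition.contDiff.comp (by fun_prop)).mul
    (Real.smoothTransition.contDiff.comp (by fun_prop))

theorem abs_timeCutoff_le (T : ℝ) (k : ℕ) (t : ℝ) : |timeCutoff T k t| ≤ 1 := by
  unfold timeCutoff
  rw [abs_of_nonneg (mul_nonneg (Real.smoothTransition.nonneg _) (Real.smoothTransition.nonneg _))]
  exact mul_le_one₀ (Real.smoothTransition.le_one _) (Real.smoothTransition.nonneg _)
    (Real.smoothTransition.le_one _)

theorem tendsto_timeCutoff {T t : ℝ} (ht : 0 < t) (htT : t < T) :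
    Tendsto (fun k => timeCutoff T k t) atTop (𝓝 1) := by
  apply tendsto_const_nhds.congr'
  have h : Tendsto (fun k : ℕ => (k : ℝ) * (T - t)) atTop atTop :=
    tendsto_natCast_atTop_atTop.atTop_mul_const (sub_pos.2 htT)
  filter_upwards [h.eventually_ge_atTop 2] with k hk
  unfold timeCutoff
  rw [Real.smoothTransition.one_of_one_le (by linarith),
    Real.smoothTransition.one_of_one_le (by linarith), one_mul]

theorem timeCutoff_eventually_zero {T t : ℝ} (k : ℕ) (ht : T ≤ t) :
    timeCutoff T k =ᶠ[𝓝 t] 0 := by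
  have h : ContinuousAt (fun s : ℝ => (k : ℝ) * (T - s) - 1) t := by fun_prop
  have h0 : (k : ℝ) * (T - t) - 1 < 0 := by
    have : (k : ℝ) * (T - t) ≤ 0 := mul_nonpos_of_nonneg_of_nonpos k.cast_nonneg (by linarith)
    linarith
  filter_upwards [h.eventually_lt continuousAt_const h0] with s hs
  simp [timeCutoff, Real.smoothTransition.zero_of_nonpos hs.le]

theorem timeCutoff_eq_zero_of_notMem {T t : ℝ} {k : ℕ} (ht : t ∉ Icc (-2) T) :
    timeCutoff T k t = 0 := by
  rw [mem_Icc, not_and_or, not_le, not_le] at ht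
  rcases ht with ht | ht
  · simp [timeCutoff, Real.smoothTransition.zero_of_nonpos (show t + 2 ≤ 0 by linarith)]
  · exact (timeCutoff_eventually_zero k ht.le).self_of_nhds

/-- Localization in time of the weak formulation, with test functions of arbitrary support. -/
theorem isWeakDivergence_of_weakForm {N : ℕ} {Ω : Set (Euc N)} (hΩ : MeasurableSet Ω)
    (hΩb : Bornology.IsBounded Ω) {T : ℝ} (hT : 0 < T) {ρ₀ : Euc N → ℝ}
    {ρ d : ℝ → Euc N → ℝ} {A : ℝ × Euc N → Euc N}
    (hd : HasTimeDerivUpTo Ω T ρ₀ ρ d) (hρ₀ : IntegrableOn ρ₀ Ω)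
    (hρ : Integrable (fun z : ℝ × Euc N => ρ z.1 z.2) (spaceTimeMeasure Ω T))
    (hA : Integrable (fun z => ρ z.1 z.2 • A z) (spaceTimeMeasure Ω T))
    (heq : ∀ φ : ℝ → Euc N → ℝ, ContDiff ℝ ∞ (fun z : ℝ × Euc N => φ z.1 z.2) →
      HasCompactSupport (fun z : ℝ × Euc N => φ z.1 z.2) →
      ∫ z, ρ z.1 z.2 * (deriv (fun s => φ s z.2) z.1 - inner ℝ (A z) (spaceGrad φ z.1 z.2))
        ∂(halfSpaceTimeMeasure Ω) = -∫ x in Ω, ρ₀ x * φ 0 x) :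
    IsWeakDivergence Ω T (fun z => d z.1 z.2) (fun z => ρ z.1 z.2 • A z) := by
  intro Φ hΦ
  have hne : ((⊤ : ℕ∞) : WithTop ℕ∞) ≠ 0 := by simp
  have hle : (1 : WithTop ℕ∞) ≤ ((⊤ : ℕ∞) : WithTop ℕ∞) := by exact_mod_cast le_top
  obtain ⟨R, hR⟩ := hΩb.subset_ball (0 : Euc N)
  -- The bump equals 1 near every point of `Ω`, so it provides compact support in space without
  -- changing values or gradients on `Ω`.
  let χ : ContDiffBump (0 : Euc N) := ⟨max R 1, max R 1 + 1, by positivity, by linarith⟩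
  have hχ : ∀ x ∈ Ω, (χ : Euc N → ℝ) =ᶠ[𝓝 x] 1 := fun x hx =>
    χ.eventuallyEq_one_of_mem_ball (Metric.ball_subset_ball (le_max_left _ _) (hR hx))
  set φ : ℕ → ℝ → Euc N → ℝ := fun k t x => timeCutoff T k t * (χ x * Φ t x) with hφ
  have hφs : ∀ k, ContDiff ℝ ∞ (fun z : ℝ × Euc N => φ k z.1 z.2) := fun k =>
    ((contDiff_timeCutoff T k).comp contDiff_fst).mul ((χ.contDiff.comp contDiff_snd).mul hΦ)
  have hφc : ∀ k, HasCompactSupport (fun z : ℝ × Euc N => φ k z.1 z.2) := by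
    intro k
    apply HasCompactSupport.intro ((isCompact_Icc (a := (-2 : ℝ)) (b := T)).prod
      χ.hasCompactSupport.isCompact)
    intro z hz
    rw [mem_prod, not_and_or] at hz
    rcases hz with hz | hz
    · simp [hφ, timeCutoff_eq_zero_of_notMem hz]
    · simp [hφ, image_eq_zero_of_notMem_tsupport hz]
  have hgrad : ∀ k, ∀ z : ℝ × Euc N, z.2 ∈ Ω →
      spaceGrad (φ k) z.1 z.2 = timeCutoff T k z.1 • spaceGrad Φ z.1 z.2 := by
    intro k z hz
    have h1 : φ k z.1 =ᶠ[𝓝 z.2] fun x => timeCutoff T k z.1 * Φ z.1 x := by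
      filter_upwards [hχ z.2 hz] with x hx
      simp [hφ, hx]
    have h2 := (hasGradientAt_space (hΦ.differentiable hne) z.1 z.2).hasFDerivAt.const_mul
      (timeCutoff T k z.1)
    rw [← map_smul] at h2
    exact ((hasGradientAt_iff_hasFDerivAt.2 h2).congr_of_eventuallyEq h1).gradient
  have hzero : ∀ k, ∀ z : ℝ × Euc N, T ≤ z.1 →
      deriv (fun s => φ k s z.2) z.1 = 0 := by
    intro k z hz
    have h1 : (fun s => φ k s z.2) =ᶠ[𝓝 z.1] fun _ => 0 := by
      filter_upwards [timeCutoff_eventually_zero k hz] with s hs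
      simp [hφ, hs]
    rw [h1.deriv_eq, deriv_const]
  have hfin := isFiniteMeasure_spaceTimeMeasure hΩb T
  have hmul : ∀ {f g : ℝ × Euc N → ℝ}, Integrable f (spaceTimeMeasure Ω T) → Continuous g →
      Integrable (fun z => f z * g z) (spaceTimeMeasure Ω T) := by
    intro f g hf hg
    obtain ⟨C, hC⟩ := exists_bound_ae_spaceTimeMeasure hΩ hΩb T hg
    exact hf.mul_bdd hg.aestronglyMeasurable hC
  have hin : ∀ {g : ℝ × Euc N → Euc N}, Continuous g →
      Integrable (fun z => inner ℝ (ρ z.1 z.2 • A z) (g z)) (spaceTimeMeasure Ω T) := by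
    intro g hg
    obtain ⟨C, hC⟩ := exists_bound_ae_spaceTimeMeasure hΩ hΩb T hg
    refine (hA.norm.mul_const C).mono' (hA.aestronglyMeasurable.inner hg.aestronglyMeasurable) ?_
    filter_upwards [hC] with z hz
    exact (norm_inner_le_norm _ _).trans (by gcongr)
  have hstep : ∀ k, ∫ z, d z.1 z.2 * φ k z.1 z.2 ∂(spaceTimeMeasure Ω T) =
      -∫ z, inner ℝ (ρ z.1 z.2 • A z) (spaceGrad (φ k) z.1 z.2) ∂(spaceTimeMeasure Ω T) := by
    intro k
    have h1 := heq (φ k) (hφs k) (hφc k)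
    have hmem : ∀ᵐ z ∂(halfSpaceTimeMeasure Ω), z.1 ∈ Ioi (0 : ℝ) ∧ z.2 ∈ Ω := by
      rw [halfSpaceTimeMeasure, Measure.prod_restrict]
      exact ae_restrict_mem (measurableSet_Ioi.prod hΩ)
    rw [← setIntegral_eq_integral_of_ae_compl_eq_zero (s := Ioo 0 T ×ˢ univ),
      ← spaceTimeMeasure_eq_restrict] at h1
    -- The boundary term produced at time 0 cancels the initial datum in the weak formulation.
    · have h2 := hd.integral_mul_deriv hT.le (φ := φ k)
        (fun x => (contDiff_time (hφs k) x).of_le hle)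
        (fun x => by simp [hφ, (timeCutoff_eventually_zero k le_rfl).self_of_nhds])
        (by
          have hc : Continuous fun x => φ k 0 x :=
            (hφs k).continuous.comp (continuous_const.prodMk continuous_id)
          obtain ⟨C, hC⟩ := exists_bound_space hΩ hΩb hc
          exact hρ₀.mul_bdd hc.aestronglyMeasurable hC)
        (hmul hρ (continuous_timeDeriv ((hφs k).of_le hle)))
        (hmul hd.integrable (hφs k).continuous)
      have h3 : ∫ z, ρ z.1 z.2 * (deriv (fun s => φ k s z.2) z.1 -
          inner ℝ (A z) (spaceGrad (φ k) z.1 z.2)) ∂(spaceTimeMeasure Ω T) =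
          ∫ z, ρ z.1 z.2 * deriv (fun s => φ k s z.2) z.1 ∂(spaceTimeMeasure Ω T) -
          ∫ z, inner ℝ (ρ z.1 z.2 • A z) (spaceGrad (φ k) z.1 z.2) ∂(spaceTimeMeasure Ω T) := by
        rw [← integral_sub (hmul hρ (continuous_timeDeriv ((hφs k).of_le hle)))
          (hin (continuous_spaceGrad ((hφs k).of_le hle)))]
        simp_rw [real_inner_smul_left, mul_sub]
      rw [h3, h2] at h1
      linarith
    · filter_upwards [hmem] with z hz hzn
      have hz1 : T ≤ z.1 := by
        by_contra hlt
        exact hzn ⟨⟨hz.1, not_le.1 hlt⟩, mem_univ _⟩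
      rw [hzero k z hz1, hgrad k z hz.2, (timeCutoff_eventually_zero k hz1).self_of_nhds]
      simp
  -- After the integration by parts no derivative falls on the cutoff, so dominated convergence
  -- suffices to remove it.
  have hlim1 : Tendsto (fun k => ∫ z, d z.1 z.2 * φ k z.1 z.2 ∂(spaceTimeMeasure Ω T)) atTop
      (𝓝 (∫ z, d z.1 z.2 * Φ z.1 z.2 ∂(spaceTimeMeasure Ω T))) := by
    refine tendsto_integral_of_dominated_convergence _
      (fun k => (hmul hd.integrable (hφs k).continuous).aestronglyMeasurable)
      (hmul hd.integrable hΦ.continuous).norm (fun k => ?_) ?_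
    · filter_upwards [ae_spaceTimeMeasure_mem hΩ T] with z hz
      simp only [hφ, (hχ z.2 hz.2).self_of_nhds, Pi.one_apply, one_mul, norm_mul]
      gcongr
      exact mul_le_of_le_one_left (norm_nonneg _) (abs_timeCutoff_le _ _ _)
    · filter_upwards [ae_spaceTimeMeasure_mem hΩ T] with z hz
      simp only [hφ, (hχ z.2 hz.2).self_of_nhds, Pi.one_apply, one_mul]
      simpa using ((tendsto_timeCutoff hz.1.1 hz.1.2).mul_const (Φ z.1 z.2)).const_mul (d z.1 z.2)
  have hlim2 : Tendsto (fun k => ∫ z, inner ℝ (ρ z.1 z.2 • A z) (spaceGrad (φ k) z.1 z.2)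
      ∂(spaceTimeMeasure Ω T)) atTop (𝓝 (∫ z, inner ℝ (ρ z.1 z.2 • A z) (spaceGrad Φ z.1 z.2)
      ∂(spaceTimeMeasure Ω T))) := by
    refine tendsto_integral_of_dominated_convergence _
      (fun k => (hin (continuous_spaceGrad ((hφs k).of_le hle))).aestronglyMeasurable)
      (hin (continuous_spaceGrad (hΦ.of_le hle))).norm (fun k => ?_) ?_
    · filter_upwards [ae_spaceTimeMeasure_mem hΩ T] with z hz
      rw [hgrad k z hz.2, real_inner_smul_right, norm_mul]
      exact mul_le_of_le_one_left (norm_nonneg _) (abs_timeCutoff_le _ _ _)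
    · filter_upwards [ae_spaceTimeMeasure_mem hΩ T] with z hz
      simp_rw [hgrad _ z hz.2, real_inner_smul_right]
      simpa using (tendsto_timeCutoff hz.1.1 hz.1.2).mul_const
        (inner ℝ (ρ z.1 z.2 • A z) (spaceGrad Φ z.1 z.2))
  simp_rw [hstep] at hlim1
  exact tendsto_nhds_unique hlim1 hlim2.neg

/-! ### Nonlinear test functions. -/

/-- A smooth function of a limit of smooth functions is an admissible test function. -/
theorem IsWeakDivergence.integral_comp {N : ℕ} {Ω : Set (Euc N)} {T : ℝ}
    {D : ℝ × Euc N → ℝ} {B : ℝ × Euc N → Euc N}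
    (h : IsWeakDivergence Ω T D B) (hD : Integrable D (spaceTimeMeasure Ω T))
    (hB : AEStronglyMeasurable B (spaceTimeMeasure Ω T))
    {v : ℝ × Euc N → ℝ} {W : ℝ × Euc N → Euc N} {ψ : ℕ → ℝ → Euc N → ℝ}
    (hψ : ∀ n, ContDiff ℝ ∞ fun z : ℝ × Euc N => ψ n z.1 z.2)
    (hv : ∀ᵐ z ∂(spaceTimeMeasure Ω T), Tendsto (fun n => ψ n z.1 z.2) atTop (𝓝 (v z)))
    (hW : ∀ᵐ z ∂(spaceTimeMeasure Ω T),
      Tendsto (fun n => spaceGrad (ψ n) z.1 z.2) atTop (𝓝 (W z)))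
    {H : ℝ × Euc N → ℝ} (hH : Integrable H (spaceTimeMeasure Ω T))
    (hdom : ∀ n, ∀ᵐ z ∂(spaceTimeMeasure Ω T), ‖B z‖ * ‖spaceGrad (ψ n) z.1 z.2‖ ≤ H z)
    {σ : ℝ → ℝ} (hσ : ContDiff ℝ ∞ σ) {K K' : ℝ} (hK : ∀ s, |σ s| ≤ K)
    (hK' : ∀ s, |deriv σ s| ≤ K') :
    ∫ z, D z * σ (v z) ∂(spaceTimeMeasure Ω T) =
      -∫ z, deriv σ (v z) * inner ℝ (B z) (W z) ∂(spaceTimeMeasure Ω T) := by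
  have hne : ((⊤ : ℕ∞) : WithTop ℕ∞) ≠ 0 := by simp
  have hle : (1 : WithTop ℕ∞) ≤ ((⊤ : ℕ∞) : WithTop ℕ∞) := by exact_mod_cast le_top
  have hdσ : Continuous (deriv σ) := hσ.continuous_deriv hle
  have hgrad : ∀ n t x, spaceGrad (fun t x => σ (ψ n t x)) t x =
      deriv σ (ψ n t x) • spaceGrad (ψ n) t x := by
    intro n t x
    have h1 := (hasGradientAt_space ((hψ n).differentiable hne) t x).hasFDerivAt
    have h2 := ((hσ.differentiable hne) (ψ n t x)).hasDerivAt.comp_hasFDerivAt x h1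
    rw [← map_smul] at h2
    exact (hasGradientAt_iff_hasFDerivAt.2 h2).gradient
  have hstep : ∀ n, ∫ z, D z * σ (ψ n z.1 z.2) ∂(spaceTimeMeasure Ω T) =
      -∫ z, deriv σ (ψ n z.1 z.2) * inner ℝ (B z) (spaceGrad (ψ n) z.1 z.2)
        ∂(spaceTimeMeasure Ω T) := by
    intro n
    have := h (fun t x => σ (ψ n t x)) (hσ.comp (hψ n))
    simpa only [hgrad, real_inner_smul_right] using this
  have hlim1 : Tendsto (fun n => ∫ z, D z * σ (ψ n z.1 z.2) ∂(spaceTimeMeasure Ω T)) atTop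
      (𝓝 (∫ z, D z * σ (v z) ∂(spaceTimeMeasure Ω T))) := by
    refine tendsto_integral_of_dominated_convergence _
      (fun n => hD.aestronglyMeasurable.mul
        (hσ.continuous.comp (hψ n).continuous).aestronglyMeasurable)
      (hD.norm.mul_const K) (fun n => ?_) ?_
    · refine Eventually.of_forall fun z => ?_
      rw [norm_mul]
      exact mul_le_mul_of_nonneg_left (hK _) (norm_nonneg _)
    · filter_upwards [hv] with z hz
      exact ((hσ.continuous.tendsto _).comp hz).const_mul _
  have hlim2 : Tendsto (fun n => ∫ z, deriv σ (ψ n z.1 z.2) *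
      inner ℝ (B z) (spaceGrad (ψ n) z.1 z.2) ∂(spaceTimeMeasure Ω T)) atTop
      (𝓝 (∫ z, deriv σ (v z) * inner ℝ (B z) (W z) ∂(spaceTimeMeasure Ω T))) := by
    refine tendsto_integral_of_dominated_convergence (fun z => K' * H z)
      (fun n => (hdσ.comp (hψ n).continuous).aestronglyMeasurable.mul
        (hB.inner (continuous_spaceGrad ((hψ n).of_le hle)).aestronglyMeasurable))
      (hH.const_mul K') (fun n => ?_) ?_
    · filter_upwards [hdom n] with z hz
      rw [norm_mul]
      exact mul_le_mul (hK' _) ((norm_inner_le_norm _ _).trans hz) (norm_nonneg _)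
        ((abs_nonneg _).trans (hK' 0))
    · filter_upwards [hv, hW] with z hz hz'
      exact ((hdσ.tendsto _).comp hz).mul (tendsto_const_nhds.inner hz')
  simp_rw [hstep] at hlim1
  exact tendsto_nhds_unique hlim1 hlim2.neg

/-- The test function is `θ(k v)`, with θ the smooth transition. The lower bound `-(v g)` has a
factor `v`, which compensates the factor `k` from the chain rule: what remains is `k v θ'(k v) g`,
bounded uniformly in k and tending to 0 pointwise. -/
theorem IsWeakDivergence.integral_indicator_nonpos {N : ℕ} {Ω : Set (Euc N)} {T : ℝ}
    {D : ℝ × Euc N → ℝ} {B : ℝ × Euc N → Euc N}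
    (h : IsWeakDivergence Ω T D B) (hD : Integrable D (spaceTimeMeasure Ω T))
    (hB : AEStronglyMeasurable B (spaceTimeMeasure Ω T))
    {v : ℝ × Euc N → ℝ} {W : ℝ × Euc N → Euc N} {ψ : ℕ → ℝ → Euc N → ℝ}
    (hψ : ∀ n, ContDiff ℝ ∞ fun z : ℝ × Euc N => ψ n z.1 z.2)
    (hv : ∀ᵐ z ∂(spaceTimeMeasure Ω T), Tendsto (fun n => ψ n z.1 z.2) atTop (𝓝 (v z)))
    (hW : ∀ᵐ z ∂(spaceTimeMeasure Ω T),
      Tendsto (fun n => spaceGrad (ψ n) z.1 z.2) atTop (𝓝 (W z)))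
    {H : ℝ × Euc N → ℝ} (hH : Integrable H (spaceTimeMeasure Ω T))
    (hdom : ∀ n, ∀ᵐ z ∂(spaceTimeMeasure Ω T), ‖B z‖ * ‖spaceGrad (ψ n) z.1 z.2‖ ≤ H z)
    {g : ℝ × Euc N → ℝ} (hg : Integrable g (spaceTimeMeasure Ω T))
    (hBW : ∀ᵐ z ∂(spaceTimeMeasure Ω T), 0 < v z → -(v z * g z) ≤ inner ℝ (B z) (W z)) :
    ∫ z, {z | 0 < v z}.indicator D z ∂(spaceTimeMeasure Ω T) ≤ 0 := by
  have hle : (1 : WithTop ℕ∞) ≤ ((⊤ : ℕ∞) : WithTop ℕ∞) := by exact_mod_cast le_top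
  obtain ⟨K, hK0, hK⟩ := Real.smoothTransition.exists_deriv_le
  have hvm : AEStronglyMeasurable v (spaceTimeMeasure Ω T) :=
    aestronglyMeasurable_of_tendsto_ae atTop (fun n => (hψ n).continuous.aestronglyMeasurable) hv
  have hWm : AEStronglyMeasurable W (spaceTimeMeasure Ω T) :=
    aestronglyMeasurable_of_tendsto_ae atTop
      (fun n => (continuous_spaceGrad ((hψ n).of_le hle)).aestronglyMeasurable) hW
  have hBWi : Integrable (fun z => inner ℝ (B z) (W z)) (spaceTimeMeasure Ω T) := by
    refine hH.mono' (hB.inner hWm) ?_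
    filter_upwards [ae_all_iff.2 hdom, hW] with z h1 h2
    exact (norm_inner_le_norm _ _).trans
      (le_of_tendsto (h2.norm.const_mul ‖B z‖) (Eventually.of_forall h1))
  have hds : Continuous (deriv Real.smoothTransition) := Real.smoothTransition.continuous_deriv
  have hd0 : ∀ s, 0 ≤ deriv Real.smoothTransition s := fun s =>
    Real.smoothTransition.monotone.deriv_nonneg
  -- Since `θ'` lives on `[0, 1]`, the weight `s` costs nothing; the bound is applied at `s = k v`.
  have hsd : ∀ s, |s * deriv Real.smoothTransition s| ≤ K := by
    intro s
    by_cases hs : s ∈ Icc (0 : ℝ) 1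
    · rw [abs_mul, abs_of_nonneg hs.1]
      exact (mul_le_of_le_one_left (abs_nonneg _) hs.2).trans (hK s)
    · rw [Real.smoothTransition.deriv_eq_zero]
      · simpa using hK0
      · rw [mem_Icc, not_and_or, not_le, not_le] at hs
        exact hs.imp le_of_lt le_of_lt
  have hder : ∀ (k : ℕ) (s : ℝ), deriv (fun s => Real.smoothTransition (k * s)) s =
      k * deriv Real.smoothTransition (k * s) := fun k s => by
    rw [deriv_comp_mul_left, smul_eq_mul]
  have hcomp : ∀ {f : ℝ → ℝ}, Continuous f → ∀ k : ℕ,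
      AEStronglyMeasurable (fun z => f (k * v z)) (spaceTimeMeasure Ω T) := fun hf k =>
    hf.comp_aestronglyMeasurable (hvm.const_mul (k : ℝ))
  have hIg : ∀ k : ℕ, Integrable
      (fun z => (k * v z * deriv Real.smoothTransition (k * v z)) * g z)
      (spaceTimeMeasure Ω T) := fun k =>
    hg.bdd_mul (hcomp (continuous_id.mul hds) k) (Eventually.of_forall fun z => hsd _)
  have hineq : ∀ k : ℕ, ∫ z, D z * Real.smoothTransition (k * v z) ∂(spaceTimeMeasure Ω T) ≤
      ∫ z, (k * v z * deriv Real.smoothTransition (k * v z)) * g z ∂(spaceTimeMeasure Ω T) := by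
    intro k
    rw [h.integral_comp hD hB hψ hv hW hH hdom (σ := fun s => Real.smoothTransition (k * s))
      (K := 1) (K' := k * K) (Real.smoothTransition.contDiff.comp (by fun_prop))
      (fun s => by
        rw [abs_of_nonneg (Real.smoothTransition.nonneg _)]
        exact Real.smoothTransition.le_one _)
      (fun s => by
        rw [hder, abs_mul, Nat.abs_cast]
        exact mul_le_mul_of_nonneg_left (hK _) k.cast_nonneg), ← integral_neg]
    refine integral_mono_ae (Integrable.neg ?_) (hIg k) ?_
    · simp_rw [hder, mul_assoc]
      exact (hBWi.bdd_mul (hcomp hds k) (Eventually.of_forall fun z => hK _)).const_mul _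
    · filter_upwards [hBW] with z hz
      simp only [hder]
      rcases le_or_gt (v z) 0 with hv0 | hv0
      · rw [Real.smoothTransition.deriv_eq_zero
          (Or.inl (mul_nonpos_of_nonneg_of_nonpos k.cast_nonneg hv0))]
        simp
      · have h1 := mul_le_mul_of_nonneg_left (hz hv0)
          (mul_nonneg k.cast_nonneg (hd0 (k * v z)))
        linarith
  have hlim1 : Tendsto (fun k : ℕ => ∫ z, D z * Real.smoothTransition (k * v z)
      ∂(spaceTimeMeasure Ω T)) atTop
      (𝓝 (∫ z, {z | 0 < v z}.indicator D z ∂(spaceTimeMeasure Ω T))) := by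
    refine tendsto_integral_of_dominated_convergence _
      (fun k => hD.aestronglyMeasurable.mul (hcomp Real.smoothTransition.continuous k))
      hD.norm (fun k => Eventually.of_forall fun z => ?_) (Eventually.of_forall fun z => ?_)
    · rw [norm_mul, Real.norm_of_nonneg (Real.smoothTransition.nonneg _)]
      exact mul_le_of_le_one_right (norm_nonneg _) (Real.smoothTransition.le_one _)
    · rcases le_or_gt (v z) 0 with hv0 | hv0
      · rw [indicator_of_notMem (by simpa using hv0)]
        refine tendsto_const_nhds.congr fun k => ?_
        rw [Real.smoothTransition.zero_of_nonpos
          (mul_nonpos_of_nonneg_of_nonpos k.cast_nonneg hv0), mul_zero]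
      · rw [indicator_of_mem (by simpa using hv0)]
        refine tendsto_const_nhds.congr' ?_
        filter_upwards [(tendsto_natCast_atTop_atTop.atTop_mul_const hv0).eventually_ge_atTop
          (1 : ℝ)] with k hk
        rw [Real.smoothTransition.one_of_one_le hk, mul_one]
  -- At each point the integrand is eventually exactly 0: always where `v ≤ 0`, and as soon as `k v
  -- ≥ 1` where `v > 0`.
  have hlim2 : Tendsto (fun k : ℕ => ∫ z, (k * v z * deriv Real.smoothTransition (k * v z)) * g z
      ∂(spaceTimeMeasure Ω T)) atTop (𝓝 (∫ _, (0 : ℝ) ∂(spaceTimeMeasure Ω T))) := by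
    refine tendsto_integral_of_dominated_convergence (fun z => K * ‖g z‖)
      (fun k => (hIg k).aestronglyMeasurable)
      (hg.norm.const_mul K) (fun k => Eventually.of_forall fun z => ?_)
      (Eventually.of_forall fun z => ?_)
    · rw [norm_mul]
      exact mul_le_mul_of_nonneg_right (hsd _) (norm_nonneg _)
    · refine tendsto_const_nhds.congr' ?_
      rcases le_or_gt (v z) 0 with hv0 | hv0
      · refine Eventually.of_forall fun k => ?_
        dsimp only
        rw [Real.smoothTransition.deriv_eq_zero
          (Or.inl (mul_nonpos_of_nonneg_of_nonpos k.cast_nonneg hv0))]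
        simp
      · filter_upwards [(tendsto_natCast_atTop_atTop.atTop_mul_const hv0).eventually_ge_atTop
          (1 : ℝ)] with k hk
        rw [Real.smoothTransition.deriv_eq_zero (Or.inr hk)]
        simp
  rw [integral_zero] at hlim2
  exact le_of_tendsto_of_tendsto' hlim1 hlim2 hineq

/-! ### Almost everywhere approximation in the energy space. -/

/-- By monotone convergence the series of the `‖f n‖ ^ q` has finite integral. Its sum is therefore
finite almost everywhere, which forces the terms to 0, and it also serves as the common dominating
function `H`. -/
theorem ae_tendsto_of_tsum_lintegral_rpow_ne_top {α F : Type*} [MeasurableSpace α]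
    [NormedAddCommGroup F] {μ : Measure α} {q : α → ℝ} (hq : AEMeasurable q μ)
    (hq0 : ∀ᵐ z ∂μ, 0 < q z) {f : ℕ → α → F} (hf : ∀ n, AEStronglyMeasurable (f n) μ)
    (hsum : ∑' n, ∫⁻ z, ‖f n z‖ₑ ^ q z ∂μ ≠ ⊤) :
    (∀ᵐ z ∂μ, Tendsto (fun n => f n z) atTop (𝓝 0)) ∧
      ∃ H : α → ℝ, Integrable H μ ∧ ∀ n, ∀ᵐ z ∂μ, ‖f n z‖ ^ q z ≤ H z := by
  have hm : ∀ n, AEMeasurable (fun z => ‖f n z‖ₑ ^ q z) μ := fun n => (hf n).enorm.pow hq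
  rw [← lintegral_tsum hm] at hsum
  have hM : AEMeasurable (fun z => ∑' n, ‖f n z‖ₑ ^ q z) μ := AEMeasurable.tsum hm
  have hfin : ∀ᵐ z ∂μ, ∑' n, ‖f n z‖ₑ ^ q z < ⊤ := ae_lt_top' hM hsum
  refine ⟨?_, fun z => (∑' n, ‖f n z‖ₑ ^ q z).toReal,
    integrable_toReal_of_lintegral_ne_top hM hsum, fun n => ?_⟩
  · filter_upwards [hfin, hq0] with z hz hqz
    have h1 := ENNReal.tendsto_atTop_zero_of_tsum_ne_top hz.ne
    have h2 := (ENNReal.continuous_rpow_const (y := 1 / q z)).tendsto 0 |>.comp h1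
    rw [ENNReal.zero_rpow_of_pos (by positivity)] at h2
    rw [tendsto_zero_iff_enorm_tendsto_zero]
    refine h2.congr fun n => ?_
    simp only [Function.comp_apply]
    rw [← ENNReal.rpow_mul, mul_one_div_cancel hqz.ne', ENNReal.rpow_one]
  · filter_upwards [hfin, hq0] with z hz hqz
    have h1 := ENNReal.toReal_mono hz.ne (ENNReal.le_tsum (f := fun n => ‖f n z‖ₑ ^ q z) n)
    rwa [← ENNReal.toReal_rpow, toReal_enorm] at h1

/-- On `(0, T) × Ω`, `u` and `w` are almost everywhere limits of smooth functions and their spatial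
gradients, and the gradients are dominated in `L^{q(·)}`. -/
structure HasDominatedApprox {N : ℕ} (Ω : Set (Euc N)) (q : Euc N → ℝ) (T : ℝ)
    (u : ℝ → Euc N → ℝ) (w : ℝ → Euc N → Euc N) : Prop where
  aestronglyMeasurable :
    AEStronglyMeasurable (fun z : ℝ × Euc N => w z.1 z.2) (spaceTimeMeasure Ω T)
  integrable : Integrable (fun z : ℝ × Euc N => ‖w z.1 z.2‖ ^ q z.2) (spaceTimeMeasure Ω T)
  approx : ∃ (ψ : ℕ → ℝ → Euc N → ℝ) (H : ℝ × Euc N → ℝ),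
    (∀ n, ContDiff ℝ ∞ (fun z : ℝ × Euc N => ψ n z.1 z.2)) ∧
    (∀ᵐ z ∂(spaceTimeMeasure Ω T), Tendsto (fun n => ψ n z.1 z.2) atTop (𝓝 (u z.1 z.2))) ∧
    (∀ᵐ z ∂(spaceTimeMeasure Ω T),
      Tendsto (fun n => spaceGrad (ψ n) z.1 z.2) atTop (𝓝 (w z.1 z.2))) ∧
    Integrable H (spaceTimeMeasure Ω T) ∧
    ∀ n, ∀ᵐ z ∂(spaceTimeMeasure Ω T),
      ‖spaceGrad (ψ n) z.1 z.2 - w z.1 z.2‖ ^ q z.2 ≤ H z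

theorem hasDominatedApprox_const {N : ℕ} (Ω : Set (Euc N)) {q : Euc N → ℝ}
    (hq : ∀ᵐ x ∂(volume.restrict Ω), 1 < q x) (T c : ℝ) :
    HasDominatedApprox Ω q T (fun _ _ => c) (fun _ _ => 0) := by
  have h0 : ∀ᵐ z ∂(spaceTimeMeasure Ω T), ‖(0 : Euc N)‖ ^ q z.2 = 0 := by
    filter_upwards [ae_spaceTimeMeasure_of_space (T := T) hq] with z hz
    rw [norm_zero, Real.zero_rpow (by linarith)]
  have hg : ∀ (t : ℝ) (x : Euc N), spaceGrad (fun _ _ => c) t x = 0 := fun t x =>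
    (hasGradientAt_const x c).gradient
  refine ⟨aestronglyMeasurable_const, (integrable_zero _ _ _).congr (h0.mono fun z hz => hz.symm),
    fun _ _ _ => c, 0, fun _ => contDiff_const, ?_, ?_, integrable_zero _ _ _, fun _ => ?_⟩
  · exact Eventually.of_forall fun z => tendsto_const_nhds
  · exact Eventually.of_forall fun z => by simp only [hg]; exact tendsto_const_nhds
  · filter_upwards [h0] with z hz
    rw [hg, sub_zero, hz]
    rfl

theorem IsEnergyFunction.hasDominatedApprox {N : ℕ} {Ω : Set (Euc N)} {q : Euc N → ℝ}
    (hqm : AEMeasurable q (volume.restrict Ω)) (hq : ∀ᵐ x ∂(volume.restrict Ω), 1 < q x)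
    {u : ℝ → Euc N → ℝ} {w : ℝ → Euc N → Euc N} (h : IsEnergyFunction Ω q u w) {T : ℝ}
    (hT : 0 < T) : HasDominatedApprox Ω q T u w := by
  have hqm' : AEMeasurable (fun z : ℝ × Euc N => q z.2) (spaceTimeMeasure Ω T) :=
    hqm.comp_quasiMeasurePreserving Measure.quasiMeasurePreserving_snd
  have hq' : ∀ᵐ z ∂(spaceTimeMeasure Ω T), 0 < q z.2 :=
    (ae_spaceTimeMeasure_of_space hq).mono fun z hz => zero_lt_one.trans hz
  obtain ⟨hwm, hwi⟩ := h.memGrad T hT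
  refine ⟨hwm, ?_, ?_⟩
  · have := integrable_toReal_of_lintegral_ne_top (hwm.enorm.pow hqm') hwi.ne
    refine this.congr (Eventually.of_forall fun z => ?_)
    simp only
    rw [← ENNReal.toReal_rpow, toReal_enorm]
  · obtain ⟨ψ, hψ, h1, h2⟩ := h.approx T hT
    have h3 := h1.add h2
    rw [add_zero] at h3
    -- One subsequence serves the functions and the gradients at once, with modulars at most `2⁻ⁿ`
    -- and hence summable.
    obtain ⟨ns, -, hns⟩ := extraction_forall_of_eventually'
      (P := fun n k => modular Ω q T (fun t x => ψ k t x - u t x) +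
        modular Ω q T (fun t x => spaceGrad (ψ k) t x - w t x) ≤ (1 / 2 : ℝ≥0∞) ^ n) (fun n => by
        have := h3.eventually_le_const (show (0 : ℝ≥0∞) < (1 / 2 : ℝ≥0∞) ^ n by
          exact ENNReal.pow_pos (by simp) n)
        exact eventually_atTop.1 this)
    have hgeo : ∑' n : ℕ, (1 / 2 : ℝ≥0∞) ^ n ≠ ⊤ := by
      rw [one_div, ENNReal.tsum_geometric, ENNReal.one_sub_inv_two, inv_inv]
      simp
    have hle : (1 : WithTop ℕ∞) ≤ ((⊤ : ℕ∞) : WithTop ℕ∞) := by exact_mod_cast le_top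
    obtain ⟨c1, -⟩ := ae_tendsto_of_tsum_lintegral_rpow_ne_top hqm' hq'
      (f := fun n z => ψ (ns n) z.1 z.2 - u z.1 z.2)
      (fun n => (hψ _).continuous.aestronglyMeasurable.sub (h.memFun T hT).1)
      (ne_top_of_le_ne_top hgeo (ENNReal.tsum_le_tsum fun n =>
        le_trans le_self_add (hns n)))
    obtain ⟨c2, H, hH, hdom⟩ := ae_tendsto_of_tsum_lintegral_rpow_ne_top hqm' hq'
      (f := fun n z => spaceGrad (ψ (ns n)) z.1 z.2 - w z.1 z.2)
      (fun n => (continuous_spaceGrad ((hψ _).of_le hle)).aestronglyMeasurable.sub hwm)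
      (ne_top_of_le_ne_top hgeo (ENNReal.tsum_le_tsum fun n =>
        le_trans le_add_self (hns n)))
    refine ⟨fun n => ψ (ns n), H, fun n => hψ _, ?_, ?_, hH, hdom⟩
    · filter_upwards [c1] with z hz
      exact tendsto_sub_nhds_zero_iff.1 hz
    · filter_upwards [c2] with z hz
      exact tendsto_sub_nhds_zero_iff.1 hz

/-! ### Pointwise inequalities for the flux. -/

/-- The flux `|w|^{q-2} w`. -/
noncomputable def powerFlux {E : Type*} [NormedAddCommGroup E] [NormedSpace ℝ E] (q : ℝ) (w : E) :
    E :=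
  ‖w‖ ^ (q - 2) • w

theorem norm_powerFlux {E : Type*} [NormedAddCommGroup E] [NormedSpace ℝ E] {q : ℝ} (hq : 1 < q)
    (w : E) : ‖powerFlux q w‖ = ‖w‖ ^ (q - 1) := by
  unfold powerFlux
  rw [norm_smul, Real.norm_of_nonneg (by positivity)]
  rcases eq_or_ne w 0 with rfl | hw
  · rw [norm_zero, mul_zero, Real.zero_rpow (by linarith)]
  · rw [← Real.rpow_add_one (norm_ne_zero_iff.2 hw)]
    congr 1
    ring

/-- By Cauchy–Schwarz the pairing is at least `(‖a‖^(q-1) - ‖b‖^(q-1)) (‖a‖ - ‖b‖)`, a product of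
two factors of the same sign. -/
theorem powerFlux_monotone {E : Type*} [NormedAddCommGroup E] [InnerProductSpace ℝ E] {q : ℝ}
    (hq : 1 < q) (a b : E) : 0 ≤ inner ℝ (powerFlux q a - powerFlux q b) (a - b) := by
  have ha := norm_powerFlux hq a
  have hb := norm_powerFlux hq b
  unfold powerFlux at *
  rw [norm_smul, Real.norm_of_nonneg (by positivity)] at ha hb
  set s := ‖a‖ ^ (q - 2)
  set t := ‖b‖ ^ (q - 2)
  have hs : 0 ≤ s := by positivity
  have ht : 0 ≤ t := by positivity
  have h1 : 0 ≤ (‖a‖ ^ (q - 1) - ‖b‖ ^ (q - 1)) * (‖a‖ - ‖b‖) := by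
    rcases le_total ‖a‖ ‖b‖ with h | h
    · exact mul_nonneg_of_nonpos_of_nonpos
        (sub_nonpos.2 (Real.rpow_le_rpow (norm_nonneg _) h (by linarith))) (sub_nonpos.2 h)
    · exact mul_nonneg
        (sub_nonneg.2 (Real.rpow_le_rpow (norm_nonneg _) h (by linarith))) (sub_nonneg.2 h)
  rw [← ha, ← hb] at h1
  have h2 := mul_le_mul_of_nonneg_left (real_inner_le_norm a b) (add_nonneg hs ht)
  have h3 : inner ℝ (s • a - t • b) (a - b) =
      s * ‖a‖ ^ 2 + t * ‖b‖ ^ 2 - (s + t) * inner ℝ a b := by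
    simp only [inner_sub_left, inner_sub_right, real_inner_smul_left, real_inner_self_eq_norm_sq,
      real_inner_comm a b]
    ring
  rw [h3]
  nlinarith

/-- A substitute for Young's inequality whose constant does not depend on `q`, as a variable
exponent demands. Every number is at most the maximum `m`, and `2 m^(q-1) · 4 m = 8 m^q`. -/
theorem add_rpow_sub_one_mul_add_le {q a b c e : ℝ} (hq : 1 < q) (ha : 0 ≤ a) (hb : 0 ≤ b)
    (hc : 0 ≤ c) (he : 0 ≤ e) :
    (a ^ (q - 1) + b ^ (q - 1)) * (a + b + c + e) ≤ 8 * (a ^ q + b ^ q + c ^ q + e ^ q) := by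
  set m := max (max a b) (max c e) with hm
  have hma : a ≤ m := (le_max_left _ _).trans (le_max_left _ _)
  have hmb : b ≤ m := (le_max_right _ _).trans (le_max_left _ _)
  have hmc : c ≤ m := (le_max_left _ _).trans (le_max_right _ _)
  have hme : e ≤ m := (le_max_right _ _).trans (le_max_right _ _)
  have hm0 : 0 ≤ m := ha.trans hma
  have h1 : m ^ q ≤ a ^ q + b ^ q + c ^ q + e ^ q := by
    have := Real.rpow_nonneg ha q
    have := Real.rpow_nonneg hb q
    have := Real.rpow_nonneg hc q
    have := Real.rpow_nonneg he q
    rcases max_choice (max a b) (max c e) with h | h <;> rw [hm, h]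
    · rcases max_choice a b with h | h <;> rw [h] <;> linarith
    · rcases max_choice c e with h | h <;> rw [h] <;> linarith
  have h2 : m ^ (q - 1) * m = m ^ q := by
    rcases hm0.eq_or_lt with h | h
    · rw [← h, mul_zero, Real.zero_rpow (by linarith)]
    · rw [← Real.rpow_add_one h.ne', sub_add_cancel]
  calc (a ^ (q - 1) + b ^ (q - 1)) * (a + b + c + e)
      ≤ (m ^ (q - 1) + m ^ (q - 1)) * (m + m + m + m) := by
        have hq' : 0 ≤ q - 1 := by linarith
        gcongr
    _ = 8 * (m ^ (q - 1) * m) := by ring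
    _ ≤ _ := by rw [h2]; linarith

/-! ### Monotonicity of the energy derivative. -/

section Energy

variable {G : ℝ → ℝ}

theorem energyDeriv_of_pos {s : ℝ} (hs : 0 < s) : energyDeriv G s = deriv G s :=
  derivWithin_of_mem_nhds (Ici_mem_nhds hs)

theorem IsEnergyDensity.differentiableAt (hG : IsEnergyDensity G) {s : ℝ} (hs : 0 < s) :
    DifferentiableAt ℝ G s :=
  (hG.contDiff.differentiableOn (by norm_num)).differentiableAt (Ioi_mem_nhds hs)

theorem IsEnergyDensity.deriv_differentiableAt (hG : IsEnergyDensity G) {s : ℝ} (hs : 0 < s) :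
    DifferentiableAt ℝ (deriv G) s := by
  have h : ContDiffOn ℝ 1 (deriv G) (Ioi 0) :=
    ((contDiffOn_succ_iff_deriv_of_isOpen (n := 1) isOpen_Ioi).1
      (by simpa [one_add_one_eq_two] using hG.contDiff)).2.2
  exact (h.differentiableOn one_ne_zero).differentiableAt (Ioi_mem_nhds hs)

theorem IsEnergyDensity.energyDeriv_mono (hG : IsEnergyDensity G) {s t : ℝ} (hs : 0 ≤ s)
    (hst : s ≤ t) (hds : DifferentiableWithinAt ℝ G (Ici 0) s) :
    energyDeriv G s ≤ energyDeriv G t := by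
  rcases hst.eq_or_lt with rfl | h
  · exact le_rfl
  · have hdt : DifferentiableWithinAt ℝ G (Ici 0) t :=
      (hG.differentiableAt (hs.trans_lt h)).differentiableWithinAt
    exact (hG.convex.derivWithin_le_slope hs (hs.trans hst) h hds).trans
      (hG.convex.slope_le_derivWithin hs (hs.trans hst) h hdt)

/-- This is the mean value inequality for `G'`, and it gives the Lipschitz bound of ρ in terms of
`G'(ρ)`. The case `s = 0` is the delicate one, since `G` is `C²` only on the open half-line. -/
theorem IsEnergyDensity.mul_sub_le_energyDeriv_sub (hG : IsEnergyDensity G) {c M : ℝ}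
    (hc : ∀ s ∈ Ioc 0 M, c ≤ deriv (deriv G) s) {s t : ℝ} (hs : 0 ≤ s) (hst : s < t) (htM : t ≤ M)
    (hds : DifferentiableWithinAt ℝ G (Ici 0) s) :
    c * (t - s) ≤ energyDeriv G t - energyDeriv G s := by
  have key : ∀ r, 0 < r → r ≤ t → c * (t - r) ≤ deriv G t - deriv G r := by
    intro r hr hrt
    refine Convex.mul_sub_le_image_sub_of_le_deriv (convex_Icc r t) ?_ ?_ ?_ r
      (left_mem_Icc.2 hrt) t (right_mem_Icc.2 hrt) hrt
    · intro x hx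
      exact (hG.deriv_differentiableAt (hr.trans_le hx.1)).continuousAt.continuousWithinAt
    · intro x hx
      rw [interior_Icc] at hx
      exact (hG.deriv_differentiableAt (hr.trans hx.1)).differentiableWithinAt
    · intro x hx
      rw [interior_Icc] at hx
      exact hc x ⟨hr.trans hx.1, hx.2.le.trans htM⟩
  -- Monotonicity of `G'` replaces its continuity at `s`: the bound is proved from `r > s`, and only
  -- the left side passes to the limit.
  have h1 : ∀ r ∈ Ioc s t, c * (t - r) ≤ energyDeriv G t - energyDeriv G s := by
    intro r hr
    have h2 := key r (hs.trans_lt hr.1) hr.2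
    rw [← energyDeriv_of_pos (hs.trans_lt hr.1), ← energyDeriv_of_pos (hs.trans_lt hst)] at h2
    have h3 := hG.energyDeriv_mono hs hr.1.le hds
    linarith
  have h4 : Tendsto (fun r => c * (t - r)) (𝓝[>] s) (𝓝 (c * (t - s))) := by
    have : Continuous fun r => c * (t - r) := by fun_prop
    exact (this.tendsto s).mono_left nhdsWithin_le_nhds
  refine le_of_tendsto h4 ?_
  filter_upwards [Ioc_mem_nhdsGT hst] with r hr
  exact h1 r hr

/-- Beyond `M` the function `G` is only known to be convex. The strict gain comes from `G''(M) > 0`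
just to the right of `M`, and monotonicity preserves it afterwards. -/
theorem IsEnergyDensity.energyDeriv_lt_of_gt (hG : IsEnergyDensity G) {c M : ℝ} (hM : 0 < M)
    (hc0 : 0 < c) (hc : ∀ s ∈ Ioc 0 M, c ≤ deriv (deriv G) s) {s : ℝ} (hs : M < s) :
    energyDeriv G M < energyDeriv G s := by
  have hpos : 0 < deriv (deriv G) M := hc0.trans_le (hc M ⟨hM, le_rfl⟩)
  have h1 := (hG.deriv_differentiableAt hM).hasDerivAt.hasDerivWithinAt (s := Ioi M)
  rw [hasDerivWithinAt_iff_tendsto_slope' (by simp)] at h1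
  obtain ⟨r, hr, hr'⟩ :=
    ((h1.eventually_const_lt hpos).and (Ioc_mem_nhdsGT hs)).exists
  have hlt : deriv G M < deriv G r := (slope_pos_iff_of_le hr'.1.le).1 hr
  rw [← energyDeriv_of_pos hM, ← energyDeriv_of_pos (hM.trans hr'.1)] at hlt
  exact hlt.trans_le (hG.energyDeriv_mono (hM.trans hr'.1).le hr'.2
    (hG.differentiableAt (hM.trans hr'.1)).differentiableWithinAt)

end Energy

/-! ### The comparison principle. -/

/-- A bounded solution of `∂_t ρ = div (ρ |w|^{q-2} w)` on `(0, T) × Ω`, where `w` is the spatial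
gradient of `u`. -/
structure IsFluxSolution {N : ℕ} (Ω : Set (Euc N)) (q : Euc N → ℝ) (T : ℝ) (ρ₀ : Euc N → ℝ)
    (ρ u d : ℝ → Euc N → ℝ) (w : ℝ → Euc N → Euc N) : Prop where
  timeDeriv : HasTimeDerivUpTo Ω T ρ₀ ρ d
  measurable : AEStronglyMeasurable (fun z : ℝ × Euc N => ρ z.1 z.2) (spaceTimeMeasure Ω T)
  bounded : ∃ C : ℝ, ∀ᵐ z ∂(spaceTimeMeasure Ω T), 0 ≤ ρ z.1 z.2 ∧ ρ z.1 z.2 ≤ C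
  approx : HasDominatedApprox Ω q T u w
  equation : IsWeakDivergence Ω T (fun z => d z.1 z.2)
    (fun z => ρ z.1 z.2 • powerFlux (q z.2) (w z.1 z.2))

theorem HasDominatedApprox.integrable_smul_powerFlux {N : ℕ} {Ω : Set (Euc N)}
    (hΩb : Bornology.IsBounded Ω) {q : Euc N → ℝ}
    (hqm : AEMeasurable q (volume.restrict Ω)) (hq : ∀ᵐ x ∂(volume.restrict Ω), 1 < q x)
    {T : ℝ} {u : ℝ → Euc N → ℝ} {w : ℝ → Euc N → Euc N} (h : HasDominatedApprox Ω q T u w)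
    {ρ : ℝ × Euc N → ℝ} (hρ : AEStronglyMeasurable ρ (spaceTimeMeasure Ω T)) {C : ℝ}
    (hC : ∀ᵐ z ∂(spaceTimeMeasure Ω T), ‖ρ z‖ ≤ C) :
    Integrable (fun z => ρ z • powerFlux (q z.2) (w z.1 z.2)) (spaceTimeMeasure Ω T) := by
  have hfin := isFiniteMeasure_spaceTimeMeasure hΩb T
  have hqm' : AEMeasurable (fun z : ℝ × Euc N => q z.2) (spaceTimeMeasure Ω T) :=
    hqm.comp_quasiMeasurePreserving Measure.quasiMeasurePreserving_snd
  have hm : AEStronglyMeasurable (fun z : ℝ × Euc N => powerFlux (q z.2) (w z.1 z.2))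
      (spaceTimeMeasure Ω T) :=
    (h.aestronglyMeasurable.norm.aemeasurable.pow
      (hqm'.sub_const 2)).aestronglyMeasurable.smul h.aestronglyMeasurable
  refine Integrable.mono' (((integrable_const (1 : ℝ)).add h.integrable).const_mul C) (hρ.smul hm) ?_
  filter_upwards [hC, ae_spaceTimeMeasure_of_space (T := T) hq] with z h1 h2
  rw [norm_smul, norm_powerFlux h2]
  -- On a cylinder of finite measure the constant 1 is integrable, so integrability of `‖w‖ ^ q`
  -- suffices for the flux.
  have h3 : ‖w z.1 z.2‖ ^ (q z.2 - 1) ≤ 1 + ‖w z.1 z.2‖ ^ q z.2 := by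
    rcases le_total ‖w z.1 z.2‖ 1 with h | h
    · exact (Real.rpow_le_one (norm_nonneg _) h (by linarith)).trans
        (le_add_of_nonneg_right (by positivity))
    · exact (Real.rpow_le_rpow_of_exponent_le h (by linarith)).trans
        (le_add_of_nonneg_left zero_le_one)
  exact mul_le_mul h1 h3 (by positivity) ((norm_nonneg _).trans h1)

theorem IsFluxSolution.integrable_flux {N : ℕ} {Ω : Set (Euc N)}
    (hΩb : Bornology.IsBounded Ω) {q : Euc N → ℝ}
    (hqm : AEMeasurable q (volume.restrict Ω)) (hq : ∀ᵐ x ∂(volume.restrict Ω), 1 < q x)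
    {T : ℝ} {ρ₀ : Euc N → ℝ} {ρ u d : ℝ → Euc N → ℝ} {w : ℝ → Euc N → Euc N}
    (h : IsFluxSolution Ω q T ρ₀ ρ u d w) :
    Integrable (fun z : ℝ × Euc N => ρ z.1 z.2 • powerFlux (q z.2) (w z.1 z.2))
      (spaceTimeMeasure Ω T) := by
  obtain ⟨C, hC⟩ := h.bounded
  refine h.approx.integrable_smul_powerFlux hΩb hqm hq h.measurable (C := C) ?_
  filter_upwards [hC] with z hz
  rw [Real.norm_of_nonneg hz.1]
  exact hz.2

/-- The comparison principle. -/
theorem IsFluxSolution.le_of_initial_le {N : ℕ} {Ω : Set (Euc N)} (hΩ : MeasurableSet Ω)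
    (hΩb : Bornology.IsBounded Ω) {q : Euc N → ℝ}
    (hqm : AEMeasurable q (volume.restrict Ω)) (hq : ∀ᵐ x ∂(volume.restrict Ω), 1 < q x)
    {T : ℝ} (hT : 0 ≤ T) {σ₁ σ₂ : Euc N → ℝ} {ρ₁ u₁ d₁ ρ₂ u₂ d₂ : ℝ → Euc N → ℝ}
    {w₁ w₂ : ℝ → Euc N → Euc N} (h₁ : IsFluxSolution Ω q T σ₁ ρ₁ u₁ d₁ w₁)
    (h₂ : IsFluxSolution Ω q T σ₂ ρ₂ u₂ d₂ w₂)
    (hiff : ∀ᵐ z ∂(spaceTimeMeasure Ω T), ρ₂ z.1 z.2 < ρ₁ z.1 z.2 ↔ u₂ z.1 z.2 < u₁ z.1 z.2)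
    {L : ℝ} (hL0 : 0 ≤ L)
    (hL : ∀ᵐ z ∂(spaceTimeMeasure Ω T), ρ₂ z.1 z.2 < ρ₁ z.1 z.2 →
      w₂ z.1 z.2 = 0 ∨ ρ₁ z.1 z.2 - ρ₂ z.1 z.2 ≤ L * (u₁ z.1 z.2 - u₂ z.1 z.2))
    (hσ : ∀ᵐ x ∂(volume.restrict Ω), σ₁ x ≤ σ₂ x) :
    ∀ᵐ x ∂(volume.restrict Ω), ρ₁ T x ≤ ρ₂ T x := by
  have hne : ((⊤ : ℕ∞) : WithTop ℕ∞) ≠ 0 := by simp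
  obtain ⟨ψ₁, H₁, hψ₁, hu₁, hw₁, hH₁, hdom₁⟩ := h₁.approx.approx
  obtain ⟨ψ₂, H₂, hψ₂, hu₂, hw₂, hH₂, hdom₂⟩ := h₂.approx.approx
  obtain ⟨C₁, hC₁⟩ := h₁.bounded
  obtain ⟨C₂, hC₂⟩ := h₂.bounded
  have hq' := ae_spaceTimeMeasure_of_space (T := T) hq
  have hB₁ := h₁.integrable_flux hΩb hqm hq
  have hB₂ := h₂.integrable_flux hΩb hqm hq
  have hgrad : ∀ n t x, spaceGrad (fun t x => ψ₁ n t x - ψ₂ n t x) t x =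
      spaceGrad (ψ₁ n) t x - spaceGrad (ψ₂ n) t x := by
    intro n t x
    have h3 := (hasGradientAt_space ((hψ₁ n).differentiable hne) t x).hasFDerivAt.sub
      (hasGradientAt_space ((hψ₂ n).differentiable hne) t x).hasFDerivAt
    rw [← map_sub] at h3
    exact (hasGradientAt_iff_hasFDerivAt.2 h3).gradient
  have hle : (1 : WithTop ℕ∞) ≤ ((⊤ : ℕ∞) : WithTop ℕ∞) := by exact_mod_cast le_top
  have hdiv : IsWeakDivergence Ω T (fun z => d₁ z.1 z.2 - d₂ z.1 z.2)
      (fun z => ρ₁ z.1 z.2 • powerFlux (q z.2) (w₁ z.1 z.2) -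
        ρ₂ z.1 z.2 • powerFlux (q z.2) (w₂ z.1 z.2)) := by
    intro φ hφ
    obtain ⟨C, hC⟩ := exists_bound_ae_spaceTimeMeasure hΩ hΩb T hφ.continuous
    have hgc := continuous_spaceGrad (hφ.of_le hle)
    obtain ⟨C', hC'⟩ := exists_bound_ae_spaceTimeMeasure hΩ hΩb T hgc
    have hin : ∀ {B : ℝ × Euc N → Euc N}, Integrable B (spaceTimeMeasure Ω T) →
        Integrable (fun z => inner ℝ (B z) (spaceGrad φ z.1 z.2)) (spaceTimeMeasure Ω T) := by
      intro B hB
      refine (hB.norm.mul_const C').mono'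
        (hB.aestronglyMeasurable.inner hgc.aestronglyMeasurable) ?_
      filter_upwards [hC'] with z hz
      exact (norm_inner_le_norm _ _).trans (by gcongr)
    simp_rw [sub_mul, inner_sub_left]
    rw [integral_sub (h₁.timeDeriv.integrable.mul_bdd hφ.continuous.aestronglyMeasurable hC)
      (h₂.timeDeriv.integrable.mul_bdd hφ.continuous.aestronglyMeasurable hC),
      integral_sub (hin hB₁) (hin hB₂), h₁.equation φ hφ, h₂.equation φ hφ]
    ring
  set C := max C₁ C₂ with hCdef
  have hmain := hdiv.integral_indicator_nonpos
    (h₁.timeDeriv.integrable.sub h₂.timeDeriv.integrable)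
    (hB₁.sub hB₂).aestronglyMeasurable
    (v := fun z => u₁ z.1 z.2 - u₂ z.1 z.2) (W := fun z => w₁ z.1 z.2 - w₂ z.1 z.2)
    (ψ := fun n t x => ψ₁ n t x - ψ₂ n t x) (fun n => (hψ₁ n).sub (hψ₂ n))
    (by filter_upwards [hu₁, hu₂] with z e₁ e₂ using e₁.sub e₂)
    (by filter_upwards [hw₁, hw₂] with z e₁ e₂; simp only [hgrad]; exact e₁.sub e₂)
    -- This dominates flux times approximate gradient: each approximate gradient is at most the
    -- limit gradient plus the error, and `add_rpow_sub_one_mul_add_le` is applied to the two limits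
    -- and the two errors.
    (H := fun z => C * (8 * (‖w₁ z.1 z.2‖ ^ q z.2 + ‖w₂ z.1 z.2‖ ^ q z.2 + H₁ z + H₂ z)))
    ((((((h₁.approx.integrable.add h₂.approx.integrable).add hH₁).add hH₂).const_mul
      8).const_mul C))
    (fun n => by
      filter_upwards [hC₁, hC₂, hdom₁ n, hdom₂ n, hq'] with z c₁ c₂ e₁ e₂ hqz
      rw [hgrad]
      have a₁ : ‖ρ₁ z.1 z.2 • powerFlux (q z.2) (w₁ z.1 z.2)‖ ≤ C * ‖w₁ z.1 z.2‖ ^ (q z.2 - 1) := by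
        rw [norm_smul, norm_powerFlux hqz, Real.norm_of_nonneg c₁.1]
        exact mul_le_mul_of_nonneg_right (c₁.2.trans (le_max_left _ _)) (by positivity)
      have a₂ : ‖ρ₂ z.1 z.2 • powerFlux (q z.2) (w₂ z.1 z.2)‖ ≤ C * ‖w₂ z.1 z.2‖ ^ (q z.2 - 1) := by
        rw [norm_smul, norm_powerFlux hqz, Real.norm_of_nonneg c₂.1]
        exact mul_le_mul_of_nonneg_right (c₂.2.trans (le_max_right _ _)) (by positivity)
      have hC0 : 0 ≤ C := c₁.1.trans (c₁.2.trans (le_max_left _ _))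
      set g₁ := spaceGrad (ψ₁ n) z.1 z.2
      set g₂ := spaceGrad (ψ₂ n) z.1 z.2
      have b₁ : ‖g₁‖ ≤ ‖w₁ z.1 z.2‖ + ‖g₁ - w₁ z.1 z.2‖ := by
        simpa using norm_add_le (w₁ z.1 z.2) (g₁ - w₁ z.1 z.2)
      have b₂ : ‖g₂‖ ≤ ‖w₂ z.1 z.2‖ + ‖g₂ - w₂ z.1 z.2‖ := by
        simpa using norm_add_le (w₂ z.1 z.2) (g₂ - w₂ z.1 z.2)
      have b : ‖g₁ - g₂‖ ≤ ‖w₁ z.1 z.2‖ + ‖w₂ z.1 z.2‖ + ‖g₁ - w₁ z.1 z.2‖ + ‖g₂ - w₂ z.1 z.2‖ := by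
        linarith [norm_sub_le g₁ g₂]
      have a := (norm_sub_le (ρ₁ z.1 z.2 • powerFlux (q z.2) (w₁ z.1 z.2))
        (ρ₂ z.1 z.2 • powerFlux (q z.2) (w₂ z.1 z.2))).trans (add_le_add a₁ a₂)
      refine (mul_le_mul a b (norm_nonneg _) (by positivity)).trans ?_
      rw [← mul_add, mul_assoc]
      refine mul_le_mul_of_nonneg_left ((add_rpow_sub_one_mul_add_le hqz (norm_nonneg _)
        (norm_nonneg _) (norm_nonneg _) (norm_nonneg _)).trans ?_) hC0
      gcongr)
    (g := fun z => L * (8 * (‖w₁ z.1 z.2‖ ^ q z.2 + ‖w₂ z.1 z.2‖ ^ q z.2)))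
    (((h₁.approx.integrable.add h₂.approx.integrable).const_mul 8).const_mul L)
    (by
      filter_upwards [hC₁, hC₂, hiff, hL, hq'] with z c₁ c₂ e₁ e₂ hqz hv
      have hρ : ρ₂ z.1 z.2 < ρ₁ z.1 z.2 := e₁.2 (sub_pos.1 hv)
      set a := w₁ z.1 z.2
      set b := w₂ z.1 z.2
      -- Splitting the flux difference isolates a monotone part with weight `ρ₁ ≥ 0` and a remainder
      -- proportional to `ρ₁ - ρ₂`.
      have i₁ : inner ℝ (ρ₁ z.1 z.2 • powerFlux (q z.2) a - ρ₂ z.1 z.2 • powerFlux (q z.2) b)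
          (a - b) = ρ₁ z.1 z.2 * inner ℝ (powerFlux (q z.2) a - powerFlux (q z.2) b) (a - b) +
          (ρ₁ z.1 z.2 - ρ₂ z.1 z.2) * inner ℝ (powerFlux (q z.2) b) (a - b) := by
        rw [inner_sub_left, inner_sub_left, real_inner_smul_left, real_inner_smul_left]
        ring
      rw [i₁]
      have i₂ := mul_nonneg c₁.1 (powerFlux_monotone hqz a b)
      have pa : 0 ≤ ‖a‖ ^ q z.2 := by positivity
      have pb : 0 ≤ ‖b‖ ^ q z.2 := by positivity
      have i₃ : 0 ≤ (u₁ z.1 z.2 - u₂ z.1 z.2) * (L * (8 * (‖a‖ ^ q z.2 + ‖b‖ ^ q z.2))) := by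
        have := hv.le
        positivity
      -- Either the remainder vanishes because `w₂ = 0`, or the Lipschitz bound exchanges `ρ₁ - ρ₂`
      -- for `L (u₁ - u₂)`, the factor `v` needed in the limit.
      rcases e₂ hρ with hb | hL'
      · have : powerFlux (q z.2) b = 0 := by rw [hb]; simp [powerFlux]
        rw [this, inner_zero_left, mul_zero]
        rw [this] at i₂
        linarith
      · have i₄ : -(‖b‖ ^ (q z.2 - 1) * (‖a‖ + ‖b‖)) ≤ inner ℝ (powerFlux (q z.2) b) (a - b) := by
          have j₁ := (abs_le.1 (abs_real_inner_le_norm (powerFlux (q z.2) b) (a - b))).1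
          rw [norm_powerFlux hqz] at j₁
          have j₂ := mul_le_mul_of_nonneg_left (norm_sub_le a b)
            (Real.rpow_nonneg (norm_nonneg b) (q z.2 - 1))
          linarith
        have i₅ : ‖b‖ ^ (q z.2 - 1) * (‖a‖ + ‖b‖) ≤ 8 * (‖a‖ ^ q z.2 + ‖b‖ ^ q z.2) := by
          have j := add_rpow_sub_one_mul_add_le hqz (norm_nonneg a) (norm_nonneg b) le_rfl le_rfl
          rw [Real.zero_rpow (by linarith)] at j
          simp only [add_zero] at j
          have j₂ : 0 ≤ ‖a‖ ^ (q z.2 - 1) * (‖a‖ + ‖b‖) := by positivity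
          linarith
        have i₆ := mul_le_mul_of_nonneg_left i₄ (sub_pos.2 hρ).le
        have i₇ := mul_le_mul hL' i₅ (by positivity) (mul_nonneg hL0 hv.le)
        linarith)
  have hnp := (h₁.timeDeriv.sub hΩ h₂.timeDeriv).nonpos_of_integral_indicator_nonpos hT
    (h₁.measurable.sub h₂.measurable) (hσ.mono fun x hx => sub_nonpos.2 hx) (by
      refine le_trans (le_of_eq (integral_congr_ae ?_)) hmain
      filter_upwards [hiff] with z hz
      simp only [indicator, mem_ofPred_eq, sub_pos, hz])
  exact hnp.mono fun x hx => sub_nonpos.1 hx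

/-! ### Maximum principle and uniqueness. -/

/-- This is the barrier for the maximum principle. `IsFluxSolution` does not tie `u` to `ρ`, so the
value `c` is free and is later taken to be `G'(M)`. -/
theorem isFluxSolution_const {N : ℕ} {Ω : Set (Euc N)} {q : Euc N → ℝ}
    (hq : ∀ᵐ x ∂(volume.restrict Ω), 1 < q x) (T : ℝ) {M : ℝ} (hM : 0 ≤ M) (c : ℝ) :
    IsFluxSolution Ω q T (fun _ => M) (fun _ _ => M) (fun _ _ => c) (fun _ _ => 0)
      (fun _ _ => 0) where
  timeDeriv :=
    { integrable := integrable_zero _ _ _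
      eq_time := fun t _ => by simp
      eq_ae := by simp }
  measurable := aestronglyMeasurable_const
  bounded := ⟨M, Eventually.of_forall fun _ => ⟨hM, le_rfl⟩⟩
  approx := hasDominatedApprox_const Ω hq T c
  equation := fun φ _ => by simp [powerFlux]

theorem IsWeakSolution.exists_isFluxSolution {N : ℕ} {Ω : Set (Euc N)} (hΩ : MeasurableSet Ω)
    (hΩb : Bornology.IsBounded Ω) {q : Euc N → ℝ}
    (hqm : AEMeasurable q (volume.restrict Ω)) (hq : ∀ᵐ x ∂(volume.restrict Ω), 1 < q x)
    {G : ℝ → ℝ} {ρ₀ : Euc N → ℝ} {ρ : ℝ → Euc N → ℝ} (h : IsWeakSolution Ω q G ρ₀ ρ)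
    (hρ₀ : IntegrableOn ρ₀ Ω) (hd : HasIntegrableTimeDeriv Ω ρ) {T : ℝ} (hT : 0 < T) :
    ∃ (d : ℝ → Euc N → ℝ) (w : ℝ → Euc N → Euc N),
      IsFluxSolution Ω q T ρ₀ ρ (fun t x => energyDeriv G (ρ t x)) d w := by
  obtain ⟨d, hdT⟩ := hd.exists_upTo hΩ hρ₀ h.initial h.measurable hT
  obtain ⟨w, hw, heq⟩ := h.equation
  obtain ⟨C, hC⟩ := h.bounded
  have hfin := isFiniteMeasure_spaceTimeMeasure hΩb T
  have hle := (Measure.absolutelyContinuous_of_le (spaceTimeMeasure_le Ω T)).ae_le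
  have hm := h.measurable.mono_measure (spaceTimeMeasure_le Ω T)
  have happ := hw.hasDominatedApprox hqm hq hT
  have hb : ∀ᵐ z ∂(spaceTimeMeasure Ω T), 0 ≤ ρ z.1 z.2 ∧ ρ z.1 z.2 ≤ C := by
    filter_upwards [hle h.nonneg, hle hC] with z h1 h2 using ⟨h1, h2⟩
  have hb' : ∀ᵐ z ∂(spaceTimeMeasure Ω T), ‖ρ z.1 z.2‖ ≤ C :=
    hb.mono fun z hz => by rw [Real.norm_of_nonneg hz.1]; exact hz.2
  exact ⟨d, w, hdT, hm, ⟨C, hb⟩, happ, isWeakDivergence_of_weakForm hΩ hΩb hT hdT hρ₀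
    (Integrable.of_bound hm C hb') (happ.integrable_smul_powerFlux hΩb hqm hq hm hb') heq⟩

theorem ae_spaceTimeMeasure_of_forall_time {N : ℕ} {Ω : Set (Euc N)} {T : ℝ}
    {f : ℝ × Euc N → ℝ} (hf : AEStronglyMeasurable f (spaceTimeMeasure Ω T)) {M : ℝ}
    (h : ∀ t ∈ Ioo 0 T, ∀ᵐ x ∂(volume.restrict Ω), f (t, x) ≤ M) :
    ∀ᵐ z ∂(spaceTimeMeasure Ω T), f z ≤ M := by
  obtain ⟨g, hg, hfg⟩ := hf
  have key : ∀ᵐ z ∂(spaceTimeMeasure Ω T), g z ≤ M := by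
    rw [spaceTimeMeasure,
      Measure.ae_prod_iff_ae_ae (measurableSet_le hg.measurable measurable_const)]
    filter_upwards [Measure.ae_ae_of_ae_prod hfg, ae_restrict_mem measurableSet_Ioo] with t h1 ht
    filter_upwards [h1, h t ht] with x h2 h3
    rwa [← h2]
  filter_upwards [key, hfg] with z h1 h2
  rwa [h2]

/-- The maximum principle. -/
theorem IsWeakSolution.le_of_initial_le {N : ℕ} {Ω : Set (Euc N)} (hΩ : MeasurableSet Ω)
    (hΩb : Bornology.IsBounded Ω) {q : Euc N → ℝ}
    (hqm : AEMeasurable q (volume.restrict Ω)) (hq : ∀ᵐ x ∂(volume.restrict Ω), 1 < q x)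
    {G : ℝ → ℝ} (hG : IsEnergyDensity G) {M : ℝ} (hM : 0 < M) (hG₂ : UniformlyConvexUpTo G M)
    {ρ₀ : Euc N → ℝ} {ρ : ℝ → Euc N → ℝ} (h : IsWeakSolution Ω q G ρ₀ ρ)
    (hρ₀ : IsBoundedDensity Ω M ρ₀) (hd : HasIntegrableTimeDeriv Ω ρ) {T : ℝ} (hT : 0 < T) :
    ∀ᵐ x ∂(volume.restrict Ω), ρ T x ≤ M := by
  obtain ⟨c, hc0, hc⟩ := hG₂
  obtain ⟨d, w, hs⟩ := h.exists_isFluxSolution hΩ hΩb hqm hq hρ₀.integrable hd hT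
  have hle := (Measure.absolutelyContinuous_of_le (spaceTimeMeasure_le Ω T)).ae_le
  -- The barrier has zero gradient, so the first alternative always holds and `L = 0` is admissible.
  refine hs.le_of_initial_le hΩ hΩb hqm hq hT.le
    (isFluxSolution_const hq T hM.le (energyDeriv G M)) ?_ le_rfl
    (Eventually.of_forall fun _ _ => Or.inl rfl) hρ₀.le
  filter_upwards [hle h.nonneg, hle h.finiteDeriv] with z h1 h2
  refine ⟨hG.energyDeriv_lt_of_gt hM hc0 hc, fun hlt => ?_⟩
  by_contra hn
  exact hlt.not_ge (hG.energyDeriv_mono h1 (not_lt.1 hn) h2)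

/-- The maximum principle places ρ₁ in the range where `G'' ≥ c`. There `G'` is strictly increasing
and its inverse is Lipschitz, so the comparison principle applies with `L = c⁻¹`; exchanging the two
solutions then gives equality. -/
theorem IsWeakSolution.ae_le {N : ℕ} {Ω : Set (Euc N)} (hΩ : MeasurableSet Ω)
    (hΩb : Bornology.IsBounded Ω) {q : Euc N → ℝ}
    (hqm : AEMeasurable q (volume.restrict Ω)) (hq : ∀ᵐ x ∂(volume.restrict Ω), 1 < q x)
    {G : ℝ → ℝ} (hG : IsEnergyDensity G) {M : ℝ} (hM : 0 < M) (hG₂ : UniformlyConvexUpTo G M)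
    {ρ₀ : Euc N → ℝ} (hρ₀ : IsBoundedDensity Ω M ρ₀) {ρ₁ ρ₂ : ℝ → Euc N → ℝ}
    (h₁ : IsWeakSolution Ω q G ρ₀ ρ₁) (hd₁ : HasIntegrableTimeDeriv Ω ρ₁)
    (h₂ : IsWeakSolution Ω q G ρ₀ ρ₂) (hd₂ : HasIntegrableTimeDeriv Ω ρ₂)
    {T : ℝ} (hT : 0 ≤ T) : ∀ᵐ x ∂(volume.restrict Ω), ρ₁ T x ≤ ρ₂ T x := by
  rcases hT.eq_or_lt with rfl | hT
  · filter_upwards [h₁.initial, h₂.initial] with x e₁ e₂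
    rw [e₁, e₂]
  obtain ⟨d₁, w₁, hs₁⟩ := h₁.exists_isFluxSolution hΩ hΩb hqm hq hρ₀.integrable hd₁ hT
  obtain ⟨d₂, w₂, hs₂⟩ := h₂.exists_isFluxSolution hΩ hΩb hqm hq hρ₀.integrable hd₂ hT
  have hle := (Measure.absolutelyContinuous_of_le (spaceTimeMeasure_le Ω T)).ae_le
  have hM₁ := ae_spaceTimeMeasure_of_forall_time hs₁.measurable
    fun t ht => h₁.le_of_initial_le hΩ hΩb hqm hq hG hM hG₂ hρ₀ hd₁ ht.1
  have hM₂ := ae_spaceTimeMeasure_of_forall_time hs₂.measurable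
    fun t ht => h₂.le_of_initial_le hΩ hΩb hqm hq hG hM hG₂ hρ₀ hd₂ ht.1
  obtain ⟨c, hc0, hc⟩ := hG₂
  refine hs₁.le_of_initial_le hΩ hΩb hqm hq hT.le hs₂ ?_ (inv_nonneg.2 hc0.le) ?_
    (Eventually.of_forall fun _ => le_rfl)
  · filter_upwards [hle h₁.nonneg, hle h₁.finiteDeriv, hle h₂.nonneg, hle h₂.finiteDeriv, hM₁]
      with z p₁ f₁ p₂ f₂ m₁
    refine ⟨fun hlt => ?_, fun hlt => ?_⟩
    · have := hG.mul_sub_le_energyDeriv_sub hc p₂ hlt m₁ f₂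
      have := mul_pos hc0 (sub_pos.2 hlt)
      linarith
    · by_contra hn
      exact hlt.not_ge (hG.energyDeriv_mono p₁ (not_lt.1 hn) f₁)
  · filter_upwards [hle h₂.nonneg, hle h₂.finiteDeriv, hM₁] with z p₂ f₂ m₁ hlt
    right
    rw [inv_mul_eq_div, le_div_iff₀' hc0]
    exact hG.mul_sub_le_energyDeriv_sub hc p₂ hlt m₁ f₂

theorem aemeasurable_conjExponent {N : ℕ} {Ω : Set (Euc N)} {p : Euc N → ℝ}
    (hp : IsVariableExponent Ω p) : AEMeasurable (conjExponent p) (volume.restrict Ω) :=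
  hp.1.div (hp.1.sub_const 1)

theorem one_lt_conjExponent {N : ℕ} {Ω : Set (Euc N)} {p : Euc N → ℝ}
    (hp : IsVariableExponent Ω p) : ∀ᵐ x ∂(volume.restrict Ω), 1 < conjExponent p x := by
  obtain ⟨-, a, b, ha, hab⟩ := hp
  filter_upwards [hab] with x hx
  rw [conjExponent, one_lt_div (by linarith)]
  linarith

theorem mainTheorem2 {N : ℕ} (Ω : Set (Euc N)) (hΩ_open : IsOpen Ω)
    (hΩ_bdd : Bornology.IsBounded Ω) (hΩ_convex : Convex ℝ Ω)
    (p : Euc N → ℝ) (hp : IsVariableExponent Ω p)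
    (G : ℝ → ℝ) (hG : IsEnergyDensity G)
    (M₂ : ℝ) (hM₂ : 0 < M₂) (hG₂ : UniformlyConvexUpTo G M₂)
    (ρ₀ : Euc N → ℝ) (hρ₀ : IsBoundedDensity Ω M₂ ρ₀)
    (ρ₁ ρ₂ : ℝ → Euc N → ℝ)
    (h₁ : IsWeakSolution Ω (conjExponent p) G ρ₀ ρ₁) (hd₁ : HasIntegrableTimeDeriv Ω ρ₁)
    (h₂ : IsWeakSolution Ω (conjExponent p) G ρ₀ ρ₂) (hd₂ : HasIntegrableTimeDeriv Ω ρ₂) :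
    (∀ T : ℝ, 0 ≤ T →
      Integrable (fun x => max (ρ₁ T x - ρ₂ T x) 0) (volume.restrict Ω) ∧
        ∫ x in Ω, max (ρ₁ T x - ρ₂ T x) 0 ≤ 0) ∧
      ∀ T : ℝ, 0 ≤ T → ∀ᵐ x ∂(volume.restrict Ω), ρ₁ T x = ρ₂ T x := by
  have hqm := aemeasurable_conjExponent hp
  have hq := one_lt_conjExponent hp
  have hle : ∀ T : ℝ, 0 ≤ T → ∀ᵐ x ∂(volume.restrict Ω), ρ₁ T x ≤ ρ₂ T x := fun T hT =>
    h₁.ae_le hΩ_open.measurableSet hΩ_bdd hqm hq hG hM₂ hG₂ hρ₀ hd₁ h₂ hd₂ hT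
  have hge : ∀ T : ℝ, 0 ≤ T → ∀ᵐ x ∂(volume.restrict Ω), ρ₂ T x ≤ ρ₁ T x := fun T hT =>
    h₂.ae_le hΩ_open.measurableSet hΩ_bdd hqm hq hG hM₂ hG₂ hρ₀ hd₂ h₁ hd₁ hT
  refine ⟨fun T hT => ?_, fun T hT => ?_⟩
  · have h0 : (fun x => max (ρ₁ T x - ρ₂ T x) 0) =ᵐ[volume.restrict Ω] 0 := by
      filter_upwards [hle T hT] with x hx
      exact max_eq_right (sub_nonpos.2 hx)
    exact ⟨(integrable_zero _ _ _).congr h0.symm, by rw [integral_congr_ae h0]; simp⟩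
  · filter_upwards [hle T hT, hge T hT] with x e₁ e₂ using le_antisymm e₁ e₂
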